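/- Let $K$ be the complete graph with vertex set $[n]=\{1,\ldots,n\}$, let $c:E(K)\to\{-1,1\}$ be a labeling of its edges with $\sum_{e\in E(K)}c(e)=0$, let $F$ be a spanning forest of $K$, let $0\le k\le n$, and let $i_1,\ldots,i_k$ be distinct elements of $[n]$. For a permutation $\pi\in S_n$ let $F_\pi$ be the copy of $F$ in $K$ with edge set $\{\pi(u)\pi(v):uv\in E(F)\}$. For a set $E$ of edges of $K$ let $c(E)=\sum_{e\in E}c(e)$ and $\bar c(E)=c(E)/|E|$ (with $\bar c(\emptyset)=0$); for a graph $H$ let $c(H)=c(E(H))$, $\bar c(H)=\bar c(E(H))$ and $m(H)=|E(H)|$. Write $I=\{i_1,\ldots,i_k\}$. If $\pi$ is chosen uniformly at random from $S_n$, then $$\mathbb{E}\left[c(F_\pi)\mid(\pi(1),\ldots,\pi(k))=(i_1,\ldots,i_k)\right]=\frac{1}{(n-k)!}\sum_{\pi\in S_n:\,(\pi(1),\ldots,\pi(k))=(i_1,\ldots,i_k)}c(F_\pi),$$ and this conditional expectation equals $$c(F_\pi[I])+\sum_{j=1}^{k}\bar c\left(\{i_j\ell:\ell\in[n]\setminus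 I\}\right)\,|N_F(j)\setminus[k]|+\bar c(K-I)\,m(F-[k]),$$ where the first term is the same for all $\pi$ with $(\pi(1),\ldots,\pi(k))=(i_1,\ldots,i_k)$, of which there is at least one. Moreover, given $n$, $c$, $F$, $k$ and $i_1,\ldots,i_k$, this conditional expectation can be computed in polynomial time: there is a Turing machine that, for every such input, outputs it as a fraction of an integer and a positive integer (written in binary), within a number of steps that is polynomial in the length of the input (which is polynomial in $n$, and at least $n^2$). -/

import Mathlib

open Finset
open scoped BigOperators Nat

/-- An edge of the complete graph on the vertex set `Fin n`. -/
abbrev KEdge (n : ℕ) : Type := (⊤ : SimpleGraph (Fin n)).edgeSet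

/-- The data `K, c, F, k, i₁, …, i_k`: the complete graph `K` has vertex set `Fin n`, `c` is a
zero-sum `±1`-labeling of its edges, `F` is a spanning forest of `K`, and `i₁, …, i_k` are distinct
vertices of `K`. Vertices and positions are numbered from `0`. -/
structure EmbeddingInput where
  n : ℕ
  c : KEdge n → ℤ
  c_pm : ∀ e, c e = -1 ∨ c e = 1
  zero_sum : ∑ e, c e = 0
  F : SimpleGraph (Fin n)
  forest : F.IsAcyclic
  k : ℕ
  k_le : k ≤ n
  i : Fin k → Fin n
  i_inj : Function.Injective i

noncomputable section

/-- `c(E)`, the sum of the labels of the edges in `E`. -/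
def weight {n : ℕ} (c : KEdge n → ℤ) (E : Finset (KEdge n)) : ℤ := ∑ e ∈ E, c e

/-- The average label of the edges in `E` (it is `0` if `E` is empty). -/
def avgWeight {n : ℕ} (c : KEdge n → ℤ) (E : Finset (KEdge n)) : ℚ := (weight c E : ℚ) / (#E : ℚ)

open scoped Classical in
/-- The edge set of a graph `G` on `Fin n`, as a set of edges of the complete graph. -/
def edgesOf {n : ℕ} (G : SimpleGraph (Fin n)) : Finset (KEdge n) :=
  {e | (e : Sym2 (Fin n)) ∈ G.edgeSet}

open scoped Classical in
/-- The edge set of the subgraph `G[S]` of `G` induced by the vertex set `S`. -/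
def edgesWithin {n : ℕ} (G : SimpleGraph (Fin n)) (S : Finset (Fin n)) : Finset (KEdge n) :=
  {e | (e : Sym2 (Fin n)) ∈ G.edgeSet ∧ ∀ v ∈ (e : Sym2 (Fin n)), v ∈ S}

open scoped Classical in
/-- The set of the edges `a ℓ` of the complete graph with `ℓ ∉ S`. -/
def edgesLeaving {n : ℕ} (a : Fin n) (S : Finset (Fin n)) : Finset (KEdge n) :=
  {e | ∃ l, l ∉ S ∧ (e : Sym2 (Fin n)) = s(a, l)}

/-- The conditional expectation `𝔼[X ∣ A] = 𝔼[X · 1_A] / ℙ[A]` with respect to the uniform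
distribution on the finite set `Ω`. -/
def uniformCondExp {Ω : Type} [Fintype Ω] [DecidableEq Ω] (X : Ω → ℚ) (A : Finset Ω) : ℚ :=
  (𝔼 ω, if ω ∈ A then X ω else 0) / (𝔼 ω, if ω ∈ A then (1 : ℚ) else 0)

namespace EmbeddingInput

variable (x : EmbeddingInput)

/-- The first `k` vertices of `F`, in their given order. -/
def firstK : Finset (Fin x.n) := {v | v.val < x.k}

/-- The position `j ≤ k`, as a vertex of `F`. -/
def pos (j : Fin x.k) : Fin x.n := Fin.castLE x.k_le j

/-- The set `{i₁, …, i_k}` of the vertices of `K` that are already occupied. -/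
def used : Finset (Fin x.n) := univ.image x.i

/-- The isomorphic copy `F_π` of `F`, with edge set `{π(u)π(v) : uv ∈ E(F)}`. -/
def copy (π : Equiv.Perm (Fin x.n)) : SimpleGraph (Fin x.n) := x.F.map π

/-- The event `(π(1), …, π(k)) = (i₁, …, i_k)`. -/
def event : Finset (Equiv.Perm (Fin x.n)) := {π | ∀ j, π (x.pos j) = x.i j}

/-- The conditional expectation `𝔼[c(F_π) ∣ (π(1), …, π(k)) = (i₁, …, i_k)]` for a uniformly
random permutation `π`. -/
def condExpWeight : ℚ :=
  uniformCondExp (fun π => (weight x.c (edgesOf (x.copy π)) : ℚ)) x.event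

/-- The entry of the label matrix at `(u, v)`: whether the edge `uv` has label `1`. -/
def labelBit (u v : Fin x.n) : Bool :=
  if h : u ≠ v then decide (x.c ⟨s(u, v), by simpa using h⟩ = 1) else false

open scoped Classical in
/-- The input word: the number `n` in unary, the adjacency matrix of `F`, the label matrix
of `K`, and the list `i₁, …, i_k` in unary. The two matrices have `n²` entries each, and the unary
numerals contribute at most `n + k n` symbols, so that the length is of the order `n² + 1`. -/
def encode : List Computability.Γ' :=
  List.replicate x.n (.bit true) ++ [.comma] ++
  (List.finRange x.n).flatMap (fun u =>
    (List.finRange x.n).map (fun v => .bit (decide (x.F.Adj u v)))) ++ [.comma] ++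
  (List.finRange x.n).flatMap (fun u =>
    (List.finRange x.n).map (fun v => .bit (x.labelBit u v))) ++ [.comma] ++
  (List.finRange x.k).flatMap (fun j => List.replicate (x.i j).val (.bit true) ++ [.comma])

end EmbeddingInput

/-- The output word for a fraction `p / q`: a sign bit, `|p|` in binary, a comma, `q` in binary. -/
def encodeFraction (r : ℤ × ℕ) : List Computability.Γ' :=
  [.bit (decide (r.1 < 0))] ++ (Computability.encodeNat r.1.natAbs).map .bit ++ [.comma] ++
    (Computability.encodeNat r.2).map .bit

end

/-! The formula is linearity of expectation over the ordered edges `(u, v)` of `F`. Permutations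
fixing the first `k` positions act on the event by right multiplication, and this action can carry
`(u, v)` to every pair in `orbitPairs u v`. Every `π` in the event maps these pairs bijectively onto
`slotPairs u v`. Double counting (`card_orbitPairs_mul_sum`) therefore shows that `(π u, π v)` is
uniform on `slotPairs u v`, and `two_mul_condExpWeight` adds up the resulting averages. Sorting the
ordered edges by which ends lie among the first `k` positions gives the three terms of
`condExpWeight_eq_explicit`; the two mixed classes are mirror images, and working with doubled
quantities avoids choosing an orientation.

For the algorithm, the same averages are put over the common denominator `2 * (freeCount *
freeCountPred)`. The numerator is the difference of two natural numbers, each a fourfold sum over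
vertices of a product of tests on the input word and a small weight. All numbers involved are
polynomially bounded in the length of the input, so unary arithmetic is fast enough; only the output
is converted to binary.

The Turing machine comes from two layers. `exec_code` compiles structured programs on stacks to a
`TM2` machine, with an exact correspondence of steps. `InputExpr.evaluates` compiles arithmetic
expressions with bounded sums and access to input symbols to such programs, with a polynomial time
bound obtained by induction on the expression. It then remains to write the numerator and
denominator as expressions and to check their values on the encoded input. -/

open Computability (Γ')

/-! ### Structured stack programs and their compilation to `TM2` machines. -/

/-- Structured programs over stacks of symbols, indexed by `ℕ`, with one register that holds the
last symbol read (`none` if the stack was empty). -/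
inductive StackProg : Type
  | push (k : ℕ) (f : Option Γ' → Γ')
  | peek (k : ℕ)
  | pop (k : ℕ)
  | skip
  | seq (p q : StackProg)
  | ite (b : Option Γ' → Bool) (p q : StackProg)
  /-- Pop from the stack `k`; if the register then satisfies `b`, run `p` and repeat. -/
  | loop (k : ℕ) (b : Option Γ' → Bool) (p : StackProg)

namespace StackProg

open Turing Function

/-- The big-step semantics: `Exec p v S v' S' t` means that `p`, started with register `v` and
stacks `S`, terminates with register `v'` and stacks `S'` after `t` machine steps. -/
inductive Exec : StackProg → Option Γ' → (ℕ → List Γ') → Option Γ' → (ℕ → List Γ') → ℕ → Prop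
  | push k f v S : Exec (push k f) v S v (update S k (f v :: S k)) 1
  | peek k v S : Exec (peek k) v S (S k).head? S 1
  | pop k v S : Exec (pop k) v S (S k).head? (update S k (S k).tail) 1
  | skip v S : Exec skip v S v S 1
  | seq {p q v₁ S₁ v₂ S₂ v₃ S₃ t₁ t₂} : Exec p v₁ S₁ v₂ S₂ t₁ → Exec q v₂ S₂ v₃ S₃ t₂ →
      Exec (seq p q) v₁ S₁ v₃ S₃ (t₂ + t₁)
  | ite_true {b p v S v' S' t} (q) : b v = true → Exec p v S v' S' t →
      Exec (ite b p q) v S v' S' (t + 1)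
  | ite_false {b q v S v' S' t} (p) : b v = false → Exec q v S v' S' t →
      Exec (ite b p q) v S v' S' (t + 1)
  | loop_done {k b} (p v) {S} : b (S k).head? = false →
      Exec (loop k b p) v S (S k).head? (update S k (S k).tail) 1
  | loop_step {k b p} (v) {S v₁ S₁ v₂ S₂ t₁ t₂} : b (S k).head? = true →
      Exec p (S k).head? (update S k (S k).tail) v₁ S₁ t₁ → Exec (loop k b p) v₁ S₁ v₂ S₂ t₂ →
      Exec (loop k b p) v S v₂ S₂ (t₂ + t₁ + 1)

/-- A number that exceeds every stack index used by the program. -/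
def width : StackProg → ℕ
  | push k _ | peek k | pop k => k + 1
  | skip => 0
  | seq p q | ite _ p q => max p.width q.width
  | loop k _ p => max (k + 1) p.width

/-- The control points of the compiled program. -/
def Label : StackProg → Type
  | push _ _ | peek _ | pop _ | skip => Unit
  | seq p q => p.Label ⊕ q.Label
  | ite _ p q => Option (p.Label ⊕ q.Label)
  | loop _ _ p => Option p.Label

/-- There are finitely many control points. -/
@[reducible] def labelFintype : (p : StackProg) → Fintype p.Label
  | push _ _ | peek _ | pop _ | skip => inferInstanceAs (Fintype Unit)
  | seq p q =>
    haveI := p.labelFintype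
    haveI := q.labelFintype
    inferInstanceAs (Fintype (p.Label ⊕ q.Label))
  | ite _ p q =>
    haveI := p.labelFintype
    haveI := q.labelFintype
    inferInstanceAs (Fintype (Option (p.Label ⊕ q.Label)))
  | loop _ _ p =>
    haveI := p.labelFintype
    inferInstanceAs (Fintype (Option p.Label))

/-- The control point at which the compiled program starts. -/
def entry : (p : StackProg) → p.Label
  | push _ _ | peek _ | pop _ | skip => ()
  | seq p _ => Sum.inl p.entry
  | ite _ _ _ => none
  | loop _ _ _ => none

section Compile

/-- The stack of the machine that holds the `k`-th stack of the program. -/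
def stackIndex (M : ℕ) [NeZero M] (k : ℕ) : Fin M := ⟨k % M, Nat.mod_lt _ (NeZero.pos M)⟩

/-- The first `M` stacks. -/
def restrict {M : ℕ} (S : ℕ → List Γ') : Fin M → List Γ' := fun j => S j

variable (M : ℕ) [NeZero M]

/-- The statements of a stack machine with `M` stacks and control points `Λ`. -/
abbrev MStmt (Λ : Type) : Type := TM2.Stmt (fun _ : Fin M => Γ') Λ (Option Γ')

/-- The compiled program; `emb` places its control points among those of the whole machine, and
`next` is the statement to be executed at its end. -/
def code {Λ : Type} : (p : StackProg) → (p.Label → Λ) → MStmt M Λ → p.Label → MStmt M Λ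
  | push k f, _, next, _ => .push (stackIndex M k) f next
  | peek k, _, next, _ => .peek (stackIndex M k) (fun _ a => a) next
  | pop k, _, next, _ => .pop (stackIndex M k) (fun _ a => a) next
  | skip, _, next, _ => next
  | seq p q, emb, _, .inl l =>
      code p (fun l => emb (.inl l)) (.goto fun _ => emb (.inr q.entry)) l
  | seq _ q, emb, next, .inr l => code q (fun l => emb (.inr l)) next l
  | ite b p q, emb, _, none =>
      .branch b (.goto fun _ => emb (some (.inl p.entry)))
        (.goto fun _ => emb (some (.inr q.entry)))
  | ite _ p _, emb, next, some (.inl l) => code p (fun l => emb (some (.inl l))) next l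
  | ite _ _ q, emb, next, some (.inr l) => code q (fun l => emb (some (.inr l))) next l
  | loop k b p, emb, next, none =>
      .pop (stackIndex M k) (fun _ a => a) (.branch b (.goto fun _ => emb (some p.entry)) next)
  | loop _ _ p, emb, _, some l =>
      code p (fun l => emb (some l)) (.goto fun _ => emb none) l

variable {M}

/-- The reduction modulo `M` only makes the compilation total; it has no effect once `M` is at least
the width of the program. -/
theorem stackIndex_val {k : ℕ} (hk : k < M) : (stackIndex M k : ℕ) = k := Nat.mod_eq_of_lt hk

theorem restrict_stackIndex (S : ℕ → List Γ') {k : ℕ} (hk : k < M) :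
    restrict S (stackIndex M k) = S k := by
  rw [restrict, stackIndex_val hk]

theorem restrict_update (S : ℕ → List Γ') {k : ℕ} (hk : k < M) (l : List Γ') :
    restrict (update S k l) = update (restrict S) (stackIndex M k) l := by
  funext j
  by_cases h : j = stackIndex M k
  · subst h
    simp [restrict, stackIndex_val hk]
  · have h' : (j : ℕ) ≠ k := fun e => h (Fin.ext (by rw [stackIndex_val hk, e]))
    simp [restrict, h, h']

/-- Induction on the execution, with the continuation `next` arbitrary: inside a sequence or a loop
body it is a jump, at the end it is whatever the context supplies. Since `next` is part of the last
statement executed and not a control point, it costs no step of its own, and the step counts agree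
exactly. -/
theorem exec_code {Λ : Type} (m : Λ → MStmt M Λ) {p : StackProg} {v v' : Option Γ'}
    {S S' : ℕ → List Γ'} {t : ℕ} (h : Exec p v S v' S' t) (hw : p.width ≤ M)
    (emb : p.Label → Λ) (next : MStmt M Λ) (hm : ∀ l, m (emb l) = code M p emb next l) :
    (flip bind (TM2.step m))^[t] (some ⟨some (emb p.entry), v, restrict S⟩) =
      some (TM2.stepAux next v' (restrict S')) := by
  have first : ∀ (l : Λ) v (S : Fin M → List Γ'),
      (flip bind (TM2.step m))^[1] (some ⟨some l, v, S⟩) = some (TM2.stepAux (m l) v S) := fun _ _ _ => rfl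
  induction h generalizing next with
  | push k f v S =>
    have hk : k < M := hw
    rw [first, hm]
    simp only [code, TM2.stepAux, restrict_update _ hk, restrict_stackIndex _ hk]
  | peek k v S =>
    have hk : k < M := hw
    rw [first, hm]
    simp only [code, TM2.stepAux, restrict_stackIndex _ hk]
  | pop k v S =>
    have hk : k < M := hw
    rw [first, hm]
    simp only [code, TM2.stepAux, restrict_update _ hk, restrict_stackIndex _ hk]
  | skip v S => rw [first, hm]; rfl
  | seq _ _ ih₁ ih₂ =>
    simp only [width, max_le_iff] at hw
    -- The time of a sequence is written `t₂ + t₁`, so this rewriting leaves the steps of the first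
    -- program innermost.
    rw [iterate_add_apply]
    erw [ih₁ hw.1 (fun l => emb (.inl l)) (.goto fun _ => emb (.inr (entry _)))
      (fun l => (hm (.inl l)).trans rfl)]
    exact ih₂ hw.2 (fun l => emb (.inr l)) next (fun l => (hm (.inr l)).trans rfl)
  | ite_true q hb _ ih =>
    simp only [width, max_le_iff] at hw
    rw [iterate_add_apply, first, hm, ← ih hw.1 (fun l => emb (some (.inl l))) next
      (fun l => (hm (some (.inl l))).trans rfl)]
    simp only [code, entry, TM2.stepAux, hb, cond_true]
  | ite_false p hb _ ih =>
    simp only [width, max_le_iff] at hw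
    rw [iterate_add_apply, first, hm, ← ih hw.2 (fun l => emb (some (.inr l))) next
      (fun l => (hm (some (.inr l))).trans rfl)]
    simp only [code, entry, TM2.stepAux, hb, cond_false]
  | @loop_done k b p v S hb =>
    simp only [width, max_le_iff] at hw
    have hk : k < M := hw.1
    rw [first, hm]
    simp only [code, entry, TM2.stepAux, restrict_update _ hk, restrict_stackIndex _ hk, hb,
      cond_false]
  | @loop_step k b p v S v₁ S₁ v₂ S₂ t₁ t₂ hb _ _ ih₁ ih₂ =>
    have hw' := hw
    simp only [width, max_le_iff] at hw
    have hk : k < M := hw.1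
    rw [iterate_add_apply, iterate_add_apply, first, hm, ← ih₂ hw' emb next hm]
    congr 1
    refine Eq.trans ?_ (ih₁ hw.2 (fun l => emb (some l)) (.goto fun _ => emb none)
      (fun l => (hm (some l)).trans rfl))
    simp only [code, entry, TM2.stepAux, restrict_update _ hk, restrict_stackIndex _ hk, hb,
      cond_true]

end Compile

/-- `Runs p S S' T`: started with stacks `S`, and an arbitrary register, the program `p` ends with
stacks `S'` after at most `T` steps. -/
def Runs (p : StackProg) (S S' : ℕ → List Γ') (T : ℕ) : Prop :=
  ∀ v, ∃ v' t, t ≤ T ∧ Exec p v S v' S' t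

/-- The number of stacks of the machine that runs a program. -/
def numStacks (p : StackProg) : ℕ := max 2 p.width

instance (p : StackProg) : NeZero p.numStacks := ⟨by unfold numStacks; omega⟩

/-- The machine that runs a program, and then resets its register. -/
def machine (p : StackProg) : FinTM2 :=
  haveI := (seq p (pop 1)).labelFintype
  { K := Fin p.numStacks
    k₀ := stackIndex _ 0
    k₁ := stackIndex _ 0
    Γ := fun _ => Γ'
    Λ := (seq p (pop 1)).Label
    main := (seq p (pop 1)).entry
    σ := Option Γ'
    initialState := none
    m := code p.numStacks (seq p (pop 1)) id .halt }

/-- A halting configuration must have the initial register value `none`. Stack `1` is empty at the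
end, so the appended `pop 1` restores that value without changing the stacks; this is the extra step
in the time bound. -/
theorem computableInPolyTime {α β : Type} {ea : α → List Γ'} {eb : β → List Γ'} {f : α → β}
    (p : StackProg) (T : Polynomial ℕ)
    (h : ∀ a, Runs p (update (fun _ => []) 0 (ea a)) (update (fun _ => []) 0 (eb (f a)))
      (T.eval (ea a).length)) :
    Nonempty (TM2ComputableInPolyTime ea eb f) := by
  refine ⟨⟨⟨machine p, Equiv.refl _, Equiv.refl _⟩, T + 1, fun a => Classical.choice ?_⟩⟩
  obtain ⟨v', t, ht, hp⟩ := h a none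
  have key := exec_code (M := p.numStacks) (code p.numStacks (seq p (pop 1)) id .halt)
    (hp.seq (.pop 1 _ _)) (by simp only [width, numStacks]; omega) id .halt (fun _ => rfl)
  -- Input and output both live on stack `0`, so one identity serves the initial and the halting
  -- configuration. The decidability instance is the one stored in the machine.
  have hini : ∀ l : List Γ', (fun k : Fin p.numStacks =>
      @dite (List Γ') (k = stackIndex _ 0) ((machine p).kDecidableEq k _) (fun _ => l)
      fun _ => []) = restrict (update (fun _ => []) 0 l) := by
    intro l
    funext k
    rw [restrict_update _ (NeZero.pos _)]
    by_cases hk : k = stackIndex _ 0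
    · subst hk; simp
    · simp [hk, restrict]
  refine ⟨⟨⟨1 + t, ?_⟩, by simp; omega⟩⟩
  have e1 : initList (machine p) (ea a) = ⟨some ((seq p (pop 1)).entry), none,
      restrict (update (fun _ => []) 0 (ea a))⟩ := by
    rw [← hini]; rfl
  have e2 : haltList (machine p) (eb (f a)) = ⟨none, none,
      restrict (update (fun _ => []) 0 (eb (f a)))⟩ := by
    rw [← hini]; rfl
  have e3 : update (update (fun _ => []) 0 (eb (f a))) 1
      (update (fun _ => []) 0 (eb (f a)) 1).tail = update (fun _ => []) 0 (eb (f a)) := by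
    funext j
    rcases eq_or_ne j 1 with rfl | hj <;> simp [*]
  rw [e3] at key
  have e4 : ∀ l : List Γ', List.map (Equiv.refl Γ').invFun l = l := fun l => List.map_id l
  have e5 := (congrArg (initList (machine p)) (e4 (ea a))).trans e1
  have e6 := (congrArg (haltList (machine p)) (e4 (eb (f a)))).trans e2
  exact (congrArg (fun c => (flip bind (machine p).step)^[1 + t] (some c)) e5).trans
    (key.trans (congrArg some e6.symm))

end StackProg

/-! ### Unary numbers and basic programs. -/

/-- The unary representation of a number. -/
def unary (n : ℕ) : List Γ' := List.replicate n (.bit true)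

theorem length_unary (n : ℕ) : (unary n).length = n := List.length_replicate

theorem unary_zero : unary 0 = [] := rfl

theorem unary_succ (n : ℕ) : unary (n + 1) = .bit true :: unary n := rfl

theorem unary_append (m n : ℕ) : unary m ++ unary n = unary (m + n) :=
  List.replicate_append_replicate

theorem tail_unary (n : ℕ) : (unary n).tail = unary (n - 1) := List.tail_replicate

theorem map_const_eq_unary {α : Type*} (l : List α) :
    (l.map fun _ => Γ'.bit true).reverse = unary l.length := by
  simp [unary]

theorem head?_unary (n : ℕ) : (unary n).head?.isSome = decide (0 < n) := by
  cases n <;> simp [unary]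

namespace StackProg

open Function

theorem Exec.congr {p : StackProg} {v v' : Option Γ'} {S S' S'' : ℕ → List Γ'} {t : ℕ}
    (h : Exec p v S v' S' t) (hS : S' = S'') : Exec p v S v' S'' t := hS ▸ h

theorem Runs.congr {p : StackProg} {S S' S'' : ℕ → List Γ'} {T : ℕ}
    (h : Runs p S S' T) (hS : S' = S'') : Runs p S S'' T := hS ▸ h

theorem Runs.mono {p : StackProg} {S S' : ℕ → List Γ'} {T T' : ℕ} (h : Runs p S S' T)
    (hT : T ≤ T') : Runs p S S' T' := fun v =>
  let ⟨v', t, ht, hp⟩ := h v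
  ⟨v', t, ht.trans hT, hp⟩

theorem Runs.seq {p q : StackProg} {S₁ S₂ S₃ : ℕ → List Γ'} {T₁ T₂ : ℕ} (hp : Runs p S₁ S₂ T₁)
    (hq : Runs q S₂ S₃ T₂) : Runs (seq p q) S₁ S₃ (T₁ + T₂) := fun v =>
  let ⟨v', _, ht, hp⟩ := hp v
  let ⟨v'', _, ht', hq⟩ := hq v'
  ⟨v'', _, by omega, hp.seq hq⟩

theorem runs_push (k : ℕ) (a : Γ') (S : ℕ → List Γ') :
    Runs (push k fun _ => a) S (update S k (a :: S k)) 1 :=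
  fun v => ⟨v, 1, le_rfl, .push k _ v S⟩

/-- The rule for loops: `F i` are the stacks after `i` rounds. -/
theorem exec_loop {k : ℕ} {b : Option Γ' → Bool} {p : StackProg} (F : ℕ → ℕ → List Γ') (N T : ℕ)
    (hb : ∀ i < N, b (F i k).head? = true)
    (hp : ∀ i < N, ∃ v' t, t ≤ T ∧
      Exec p (F i k).head? (update (F i) k (F i k).tail) v' (F (i + 1)) t)
    (hN : b (F N k).head? = false) (v : Option Γ') :
    ∃ t ≤ N * (T + 1) + 1,
      Exec (loop k b p) v (F 0) (F N k).head? (update (F N) k (F N k).tail) t := by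
  induction N generalizing F v with
  | zero => exact ⟨1, by simp, .loop_done p v hN⟩
  | succ N ih =>
    obtain ⟨v', t, ht, hp'⟩ := hp 0 N.succ_pos
    obtain ⟨t', ht', hl⟩ := ih (fun i => F (i + 1)) (fun i hi => hb _ (by omega))
      (fun i hi => hp _ (by omega)) hN v'
    refine ⟨t' + t + 1, ?_, .loop_step v (hb 0 N.succ_pos) hp' hl⟩
    calc t' + t + 1 ≤ (N * (T + 1) + 1) + T + 1 := by omega
      _ = (N + 1) * (T + 1) + 1 := by ring

/-- The failing test that ends the loop pops an empty stack, so it leaves the stacks of the last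
round unchanged. -/
theorem runs_loop {k : ℕ} {p : StackProg} (F : ℕ → ℕ → List Γ') (N T : ℕ)
    (hb : ∀ i < N, (F i k).head?.isSome = true)
    (hp : ∀ i < N, ∃ v' t, t ≤ T ∧
      Exec p (F i k).head? (update (F i) k (F i k).tail) v' (F (i + 1)) t)
    (hN : F N k = []) : Runs (loop k Option.isSome p) (F 0) (F N) (N * (T + 1) + 1) := by
  intro v
  obtain ⟨t, ht, h⟩ := exec_loop F N T hb hp (by simp [hN]) v
  have e : update (F N) k (F N k).tail = F N := by
    rw [hN, List.tail_nil, ← hN, update_eq_self]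
  rw [e] at h
  exact ⟨_, t, ht, h⟩

/-- Move the stack `k` to the stack `j`, symbol by symbol, and translate the symbols by `f`. -/
def pour (k j : ℕ) (f : Option Γ' → Γ') : StackProg := loop k Option.isSome (push j f)

/-- After `i` rounds the first `i` symbols have been moved. Pouring reverses the order, so pouring
twice restores it. -/
theorem runs_pour {k j : ℕ} (h : k ≠ j) (f : Option Γ' → Γ') (S : ℕ → List Γ') :
    Runs (pour k j f) S
      (update (update S k []) j (((S k).map fun a => f (some a)).reverse ++ S j))
      (2 * (S k).length + 1) := by
  have key := runs_loop (k := k) (p := push j f)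
    (fun i => update (update S k ((S k).drop i)) j
      ((((S k).take i).map fun a => f (some a)).reverse ++ S j)) (S k).length 1 ?_ ?_ ?_
  · refine Runs.mono (T := (S k).length * (1 + 1) + 1) ?_ (by omega)
    simpa [pour] using key
  · intro i hi
    simp [h, hi]
  · intro i hi
    refine ⟨_, 1, le_rfl, (Exec.push j f _ _).congr ?_⟩
    funext l
    rcases eq_or_ne l j with rfl | hl
    · simp only [update_of_ne h, update_self, update_of_ne h.symm]
      have e : (S k).take (i + 1) = (S k).take i ++ [(S k)[i]] := by simp
      rw [e, List.map_append]
      simp [hi]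
    · rcases eq_or_ne l k with rfl | hk
      · simp [hl]
      · simp [hl, hk]
  · simp [h]

/-- Empty the stack `k`. -/
def clear (k : ℕ) : StackProg := loop k Option.isSome skip

theorem runs_clear (k : ℕ) (S : ℕ → List Γ') :
    Runs (clear k) S (update S k []) (2 * (S k).length + 1) := by
  have key := runs_loop (k := k) (p := skip) (fun i => update S k ((S k).drop i)) (S k).length 1
    ?_ ?_ ?_
  · refine Runs.mono (T := (S k).length * (1 + 1) + 1) ?_ (by omega)
    simpa [clear] using key
  · intro i hi
    simp [hi]
  · intro i hi
    refine ⟨_, 1, le_rfl, (Exec.skip _ _).congr ?_⟩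
    simp
  · simp

/-- Add the length of the stack `k`, in unary, to the stack `j`; the stack `1` is used as a scratch
stack. -/
def addLength (k j : ℕ) : StackProg :=
  seq (pour k 1 fun a => a.getD .blank)
    (loop 1 Option.isSome (seq (push k fun a => a.getD .blank) (push j fun _ => .bit true)))

/-- A nondestructive copy: the stack is poured to the scratch stack and then moved back symbol by
symbol, with one mark added to `j` for each. The two loops cost two and three steps per symbol. -/
theorem runs_addLength {k j : ℕ} (h : k ≠ j) (hk : k ≠ 1) (hj : j ≠ 1) {S : ℕ → List Γ'}
    (h1 : S 1 = []) {m : ℕ} (hm : S j = unary m) :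
    Runs (addLength k j) S (update S j (unary (m + (S k).length))) (5 * (S k).length + 2) := by
  have pourRun := runs_pour hk (fun a => a.getD .blank) S
  rw [h1] at pourRun
  simp only [Option.getD_some, List.append_nil, List.map_id'] at pourRun
  have key := runs_loop (k := 1)
    (p := seq (push k fun a => a.getD .blank) (push j fun _ => .bit true))
    (fun i => update (update (update S k (((S k).reverse.take i).reverse)) 1
      ((S k).reverse.drop i)) j (unary (m + i))) (S k).length 2 ?_ ?_ ?_
  · refine Runs.mono (T := (2 * (S k).length + 1) + ((S k).length * (2 + 1) + 1))
      (pourRun.seq ?_) (by omega)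
    convert key using 1
    · funext l
      rcases eq_or_ne l j with rfl | hl
      · simp [h.symm, hj, hm]
      · simp [hl]
    · funext l
      rcases eq_or_ne l j with rfl | hl
      · simp
      · rcases eq_or_ne l 1 with rfl | hl1
        · simp [hl, h1]
        · rcases eq_or_ne l k with rfl | hl2
          · have : (S l).reverse.take (S l).length = (S l).reverse :=
              List.take_of_length_le (by simp)
            simp [*]
          · simp [*]
  · intro i hi
    simp [hj.symm, hi]
  · intro i hi
    refine ⟨_, 1 + 1, le_rfl, ((Exec.push k _ _ _).seq (Exec.push j _ _ _)).congr ?_⟩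
    have hi' : i < (S k).reverse.length := by simpa using hi
    funext l
    rcases eq_or_ne l j with rfl | hl
    · simp [h.symm, hj, ← add_assoc, unary_succ]
    · rcases eq_or_ne l 1 with rfl | hl1
      · simp [hl, hk.symm]
      · rcases eq_or_ne l k with rfl | hl2
        · simp [*, List.take_add_one, hj.symm]
        · simp [*]
  · simp [hj.symm]

end StackProg

/-! ### Arithmetic expressions over the input word and their evaluation in polynomial time. -/

/-- Extend an environment by the value of a new variable, which gets the number `0`. -/
def scons {α : Type*} (a : α) (ρ : ℕ → α) : ℕ → α
  | 0 => a
  | j + 1 => ρ j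

/-- Arithmetic expressions over an input word, with variables in de Bruijn notation. -/
inductive InputExpr : Type
  | one
  /-- The length of the input word. -/
  | len
  | var (j : ℕ)
  | add (e₁ e₂ : InputExpr)
  | sub (e₁ e₂ : InputExpr)
  | mul (e₁ e₂ : InputExpr)
  /-- The sum of the values of `e` for all values of the new variable less than that of `b`. -/
  | sum (b e : InputExpr)
  /-- `1` if the input word has the symbol `a` at the position given by `e`, and `0` otherwise. -/
  | sym (a : Γ') (e : InputExpr)

namespace InputExpr

open Function StackProg Polynomial

/-- `1` if the word `w` has the symbol `a` at the position `i`, and `0` otherwise. -/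
def symbolAt (w : List Γ') (a : Γ') (i : ℕ) : ℕ := if w[i]? = some a then 1 else 0

/-- The value of an expression. -/
def val (w : List Γ') : InputExpr → (ℕ → ℕ) → ℕ
  | one, _ => 1
  | len, _ => w.length
  | var j, ρ => ρ j
  | add e₁ e₂, ρ => e₁.val w ρ + e₂.val w ρ
  | sub e₁ e₂, ρ => e₁.val w ρ - e₂.val w ρ
  | mul e₁ e₂, ρ => e₁.val w ρ * e₂.val w ρ
  | sum b e, ρ => ∑ i ∈ range (b.val w ρ), e.val w (scons i ρ)
  | sym a e, ρ => symbolAt w a (e.val w ρ)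

/-- A bound for the value of an expression in terms of the length of the input word and the
values of the variables. -/
noncomputable def bound : InputExpr → Polynomial ℕ
  | one | sym _ _ => 1
  | len | var _ => X
  | add e₁ e₂ => e₁.bound + e₂.bound
  | sub e₁ _ => e₁.bound
  | mul e₁ e₂ => e₁.bound * e₂.bound
  | sum b e => b.bound * e.bound.comp (X + b.bound)

theorem scons_le {i a b : ℕ} {ρ : ℕ → ℕ} (hi : i < a) (hρ : ∀ j, ρ j ≤ b) (j : ℕ) :
    scons i ρ j ≤ b + a := by
  cases j with
  | zero => exact hi.le.trans (Nat.le_add_left _ _)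
  | succ j => exact (hρ j).trans (Nat.le_add_right _ _)

/-- The parameter `L` is only an upper bound because it must grow under a summation: the new
variable may exceed `L`, but all variables stay below `L` plus the bound for the number of summands.
-/
theorem val_le (e : InputExpr) {w : List Γ'} {ρ : ℕ → ℕ} {L : ℕ} (hw : w.length ≤ L)
    (hρ : ∀ j, ρ j ≤ L) : e.val w ρ ≤ e.bound.eval L := by
  induction e generalizing ρ L with
  | one => simp [val, bound]
  | len => simpa [val, bound] using hw
  | var j => simpa [val, bound] using hρ j
  | add e₁ e₂ ih₁ ih₂ => simpa [val, bound] using add_le_add (ih₁ hw hρ) (ih₂ hw hρ)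
  | sub e₁ e₂ ih₁ ih₂ => simpa [val, bound] using (Nat.sub_le _ _).trans (ih₁ hw hρ)
  | mul e₁ e₂ ih₁ ih₂ => simpa [val, bound] using Nat.mul_le_mul (ih₁ hw hρ) (ih₂ hw hρ)
  | sum b e ihb ih =>
    have hb := ihb hw hρ
    simp only [val, bound, eval_mul, eval_comp, eval_add, eval_X]
    refine (Finset.sum_le_card_nsmul _ _ (e.bound.eval (L + b.bound.eval L)) ?_).trans ?_
    · intro i hi
      exact ih (hw.trans (Nat.le_add_right _ _))
        (scons_le ((Finset.mem_range.mp hi).trans_le hb) hρ)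
    · rw [card_range, smul_eq_mul]
      exact Nat.mul_le_mul hb le_rfl
  | sym a e => simp only [val, symbolAt, bound, eval_one]; split_ifs <;> simp

/-- A program that evaluates an expression. The input word is on the stack `0`, the value of the
variable `j` is on the stack `loc j`, the value of the expression will be pushed to the
stack `d`, and the stacks after `d`, and the stack `1`, are used as scratch stacks. -/
def compile : InputExpr → (ℕ → ℕ) → ℕ → StackProg
  | one, _, d => push d fun _ => .bit true
  | len, _, d => addLength 0 d
  | var j, loc, d => addLength (loc j) d
  | add e₁ e₂, loc, d =>
      seq (e₁.compile loc d) (seq (e₂.compile loc (d + 1)) (pour (d + 1) d fun _ => .bit true))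
  | sub e₁ e₂, loc, d =>
      seq (e₁.compile loc d)
        (seq (e₂.compile loc (d + 1)) (loop (d + 1) Option.isSome (pop d)))
  | mul e₁ e₂, loc, d =>
      seq (e₁.compile loc (d + 1)) (seq (e₂.compile loc (d + 2))
        (seq (loop (d + 1) Option.isSome (addLength (d + 2) d)) (clear (d + 2))))
  | sum b e, loc, d =>
      seq (b.compile loc (d + 1))
        (seq (loop (d + 1) Option.isSome
          (seq (e.compile (scons (d + 2) loc) (d + 3))
            (seq (pour (d + 3) d fun _ => .bit true) (push (d + 2) fun _ => .bit true))))
          (clear (d + 2)))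
  | sym a e, loc, d =>
      seq (e.compile loc (d + 1))
        (seq (loop (d + 1) Option.isSome
          (seq (pop 0) (ite Option.isSome (push 1 fun a => a.getD .blank) skip)))
          (seq (peek 0) (seq (ite (fun s => decide (s = some a)) (push d fun _ => .bit true) skip)
            (pour 1 0 fun a => a.getD .blank))))

/-- The stacks before an expression is evaluated. -/
structure Ready (loc : ℕ → ℕ) (d : ℕ) (w : List Γ') (ρ : ℕ → ℕ) (L : ℕ)
    (S : ℕ → List Γ') : Prop where
  input : S 0 = w
  scratch : S 1 = []
  env : ∀ j, S (loc j) = unary (ρ j)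
  free : ∀ j, d ≤ j → S j = []
  length_le : w.length ≤ L
  env_le : ∀ j, ρ j ≤ L

theorem Ready.mono {loc : ℕ → ℕ} {d d' : ℕ} {w : List Γ'} {ρ : ℕ → ℕ} {L : ℕ}
    {S : ℕ → List Γ'} (h : Ready loc d w ρ L S) (hd : d ≤ d') : Ready loc d' w ρ L S :=
  { h with free := fun j hj => h.free j (hd.trans hj) }

theorem Ready.update {loc : ℕ → ℕ} {d : ℕ} {w : List Γ'} {ρ : ℕ → ℕ} {L : ℕ}
    {S : ℕ → List Γ'} (h : Ready loc d w ρ L S) (hd : 2 ≤ d) (hloc : ∀ j, loc j < d)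
    (l : List Γ') : Ready loc (d + 1) w ρ L (Function.update S d l) where
  input := by rw [update_of_ne (by omega), h.input]
  scratch := by rw [update_of_ne (by omega), h.scratch]
  env j := by rw [update_of_ne (hloc j).ne, h.env]
  free j hj := by rw [update_of_ne (by omega), h.free j (by omega)]
  length_le := h.length_le
  env_le := h.env_le

/-- `Evaluates p e loc d` means that `p` pushes the value of `e` to the stack `d`, in polynomial
time, and leaves the other stacks as they were. -/
def Evaluates (p : StackProg) (e : InputExpr) (loc : ℕ → ℕ) (d : ℕ) : Prop :=
  ∃ T : Polynomial ℕ, ∀ w ρ L S, Ready loc d w ρ L S →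
    Runs p S (update S d (unary (e.val w ρ))) (T.eval L)

theorem evaluates_one {loc : ℕ → ℕ} {d : ℕ} : Evaluates (compile one loc d) one loc d := by
  refine ⟨1, fun w ρ L S h => ?_⟩
  refine ((runs_push d _ S).congr ?_).mono (by simp)
  rw [h.free d le_rfl]
  rfl

theorem evaluates_len {loc : ℕ → ℕ} {d : ℕ} (hd : 2 ≤ d) :
    Evaluates (compile len loc d) len loc d := by
  refine ⟨5 * X + 2, fun w ρ L S h => ?_⟩
  refine ((runs_addLength (m := 0) (by omega) (by omega) (by omega) h.scratch
    (h.free d le_rfl)).congr ?_).mono ?_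
  · simp [h.input, val]
  · have := h.length_le
    simp [h.input]
    omega

theorem evaluates_var {loc : ℕ → ℕ} {d : ℕ} (hd : 2 ≤ d) (hloc : ∀ j, 2 ≤ loc j ∧ loc j < d)
    (j : ℕ) : Evaluates (compile (var j) loc d) (var j) loc d := by
  have hj := hloc j
  refine ⟨5 * X + 2, fun w ρ L S h => ?_⟩
  refine ((runs_addLength (m := 0) (by omega) (by omega) (by omega) h.scratch
    (h.free d le_rfl)).congr ?_).mono ?_
  · simp [h.env, val, length_unary]
  · have := h.env_le j
    simp [h.env, length_unary]
    omega

theorem evaluates_add {loc : ℕ → ℕ} {d : ℕ} (hd : 2 ≤ d) (hloc : ∀ j, loc j < d)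
    {e₁ e₂ : InputExpr} (h₁ : Evaluates (e₁.compile loc d) e₁ loc d)
    (h₂ : Evaluates (e₂.compile loc (d + 1)) e₂ loc (d + 1)) :
    Evaluates ((add e₁ e₂).compile loc d) (add e₁ e₂) loc d := by
  obtain ⟨T₁, h₁⟩ := h₁
  obtain ⟨T₂, h₂⟩ := h₂
  refine ⟨T₁ + (T₂ + (2 * e₂.bound + 1)), fun w ρ L S h => ?_⟩
  have hv := e₂.val_le h.length_le h.env_le
  refine (((h₁ w ρ L S h).seq ((h₂ w ρ L _ (h.update hd hloc _)).seq
    (runs_pour (by omega) _ _))).congr ?_).mono ?_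
  · funext l
    rcases eq_or_ne l d with rfl | hl
    · rw [update_self, map_const_eq_unary]
      simp [val, unary_append, length_unary, add_comm]
    · rcases eq_or_ne l (d + 1) with rfl | hl'
      · simp [h.free]
      · simp [hl, hl']
  · simp [length_unary]
    omega

/-- Each mark of the subtrahend pops one mark of the minuend. Popping an empty stack does nothing,
which is exactly truncated subtraction. -/
theorem evaluates_sub {loc : ℕ → ℕ} {d : ℕ} (hd : 2 ≤ d) (hloc : ∀ j, loc j < d)
    {e₁ e₂ : InputExpr} (h₁ : Evaluates (e₁.compile loc d) e₁ loc d)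
    (h₂ : Evaluates (e₂.compile loc (d + 1)) e₂ loc (d + 1)) :
    Evaluates ((sub e₁ e₂).compile loc d) (sub e₁ e₂) loc d := by
  obtain ⟨T₁, h₁⟩ := h₁
  obtain ⟨T₂, h₂⟩ := h₂
  refine ⟨T₁ + (T₂ + (e₂.bound * 2 + 1)), fun w ρ L S h => ?_⟩
  have hv := e₂.val_le h.length_le h.env_le
  have key := runs_loop (k := d + 1) (p := pop d)
    (fun i => update (update S d (unary (e₁.val w ρ - i))) (d + 1) (unary (e₂.val w ρ - i)))
    (e₂.val w ρ) 1 ?_ ?_ ?_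
  · refine (((h₁ w ρ L S h).seq ((h₂ w ρ L _ (h.update hd hloc _)).seq key)).congr ?_).mono ?_
    · funext l
      rcases eq_or_ne l d with rfl | hl
      · simp [val]
      · rcases eq_or_ne l (d + 1) with rfl | hl'
        · simp [h.free, unary_zero]
        · simp [hl, hl']
    · simp
      omega
  · intro i hi
    simpa [head?_unary] using hi
  · intro i hi
    refine ⟨_, 1, le_rfl, (Exec.pop d _ _).congr ?_⟩
    funext l
    rcases eq_or_ne l d with rfl | hl
    · simp [tail_unary, Nat.sub_sub]
    · rcases eq_or_ne l (d + 1) with rfl | hl'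
      · simp [tail_unary, Nat.sub_sub]
      · simp [hl, hl']
  · simp [unary_zero]

/-- Repeated addition: stack `d + 1` counts down the first factor, and each round adds a copy of the
second factor, kept on `d + 2`, to the product on `d`. -/
theorem evaluates_mul {loc : ℕ → ℕ} {d : ℕ} (hd : 2 ≤ d) (hloc : ∀ j, loc j < d)
    {e₁ e₂ : InputExpr} (h₁ : Evaluates (e₁.compile loc (d + 1)) e₁ loc (d + 1))
    (h₂ : Evaluates (e₂.compile loc (d + 2)) e₂ loc (d + 2)) :
    Evaluates ((mul e₁ e₂).compile loc d) (mul e₁ e₂) loc d := by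
  obtain ⟨T₁, h₁⟩ := h₁
  obtain ⟨T₂, h₂⟩ := h₂
  refine ⟨T₁ + (T₂ + ((e₁.bound * (5 * e₂.bound + 2 + 1) + 1) + (2 * e₂.bound + 1))),
    fun w ρ L S h => ?_⟩
  have hv₁ := e₁.val_le h.length_le h.env_le
  have hv₂ := e₂.val_le h.length_le h.env_le
  have h' := (h.mono d.le_succ).update (by omega) (fun j => (hloc j).trans d.lt_succ_self)
    (unary (e₁.val w ρ))
  have key := runs_loop (k := d + 1) (p := addLength (d + 2) d)
    (fun i => update (update (update S d (unary (i * e₂.val w ρ))) (d + 1)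
      (unary (e₁.val w ρ - i))) (d + 2) (unary (e₂.val w ρ)))
    (e₁.val w ρ) (5 * e₂.val w ρ + 2) ?_ ?_ ?_
  · have start : update (update (update S d (unary (0 * e₂.val w ρ))) (d + 1)
        (unary (e₁.val w ρ - 0))) (d + 2) (unary (e₂.val w ρ)) =
        update (update S (d + 1) (unary (e₁.val w ρ))) (d + 2) (unary (e₂.val w ρ)) := by
      have : update S d (unary (0 * e₂.val w ρ)) = S := by
        rw [zero_mul, unary_zero, ← h.free d le_rfl, update_eq_self]
      rw [this, Nat.sub_zero]
    rw [start] at key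
    refine (((h₁ w ρ L S (h.mono d.le_succ)).seq ((h₂ w ρ L _ h').seq
      (key.seq (runs_clear (d + 2) _)))).congr ?_).mono ?_
    · funext l
      rcases eq_or_ne l d with rfl | hl
      · simp [val]
      · rcases eq_or_ne l (d + 1) with rfl | hl'
        · simp [h.free, unary_zero]
        · rcases eq_or_ne l (d + 2) with rfl | hl''
          · simp [h.free]
          · simp [hl, hl', hl'']
    · simp only [update_self, length_unary, eval_add, eval_mul, eval_ofNat, eval_one]
      gcongr
  · intro i hi
    simpa [head?_unary] using hi
  · intro i hi
    have hrun := runs_addLength (k := d + 2) (j := d) (by omega) (by omega) (by omega)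
      (S := update (update (update S d (unary (i * e₂.val w ρ))) (d + 2) (unary (e₂.val w ρ)))
        (d + 1) (unary (e₁.val w ρ - (i + 1)))) (m := i * e₂.val w ρ)
      (by
        rw [update_of_ne (by omega), update_of_ne (by omega), update_of_ne (by omega),
          h.scratch]) (by simp)
    have e : update (update (update (update S d (unary (i * e₂.val w ρ))) (d + 1)
        (unary (e₁.val w ρ - i))) (d + 2) (unary (e₂.val w ρ))) (d + 1)
        (unary (e₁.val w ρ - (i + 1))) = update (update (update S d (unary (i * e₂.val w ρ)))
        (d + 2) (unary (e₂.val w ρ))) (d + 1) (unary (e₁.val w ρ - (i + 1))) := by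
      funext l
      rcases eq_or_ne l (d + 1) with rfl | hl'
      · simp
      · rcases eq_or_ne l (d + 2) with rfl | hl'' <;> simp [*]
    obtain ⟨v', t, ht, hx⟩ := hrun (unary (e₁.val w ρ - i)).head?
    refine ⟨v', t, ?_, ?_⟩
    · simpa [length_unary] using ht
    · simp only [update_self, ne_eq, Nat.add_left_cancel_iff, OfNat.one_ne_ofNat,
        not_false_eq_true, update_of_ne, tail_unary, Nat.sub_sub, e]
      refine hx.congr ?_
      funext l
      rcases eq_or_ne l d with rfl | hl
      · simp [length_unary, add_mul]
      · rcases eq_or_ne l (d + 1) with rfl | hl'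
        · simp
        · rcases eq_or_ne l (d + 2) with rfl | hl'' <;> simp [*]
  · simp [unary_zero]

theorem Ready.bind {loc : ℕ → ℕ} {d : ℕ} {w : List Γ'} {ρ : ℕ → ℕ} {L : ℕ}
    {S : ℕ → List Γ'} (h : Ready loc d w ρ L S) (hd : 2 ≤ d) (hloc : ∀ j, loc j < d)
    (l₁ l₂ : List Γ') {i b : ℕ} (hi : i < b) :
    Ready (scons (d + 2) loc) (d + 3) w (scons i ρ) (L + b)
      (Function.update (Function.update (Function.update S d l₁) (d + 1) l₂) (d + 2)
        (unary i)) where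
  input := by
    rw [update_of_ne (by omega), update_of_ne (by omega), update_of_ne (by omega), h.input]
  scratch := by
    rw [update_of_ne (by omega), update_of_ne (by omega), update_of_ne (by omega), h.scratch]
  env j := by
    cases j with
    | zero => simp [scons]
    | succ j =>
      have := hloc j
      simp only [scons]
      rw [update_of_ne (by omega), update_of_ne (by omega), update_of_ne (by omega), h.env]
  free j hj := by
    rw [update_of_ne (by omega), update_of_ne (by omega), update_of_ne (by omega),
      h.free j (by omega)]
  length_le := h.length_le.trans (Nat.le_add_right _ _)
  env_le := scons_le hi h.env_le

/-- In round `i`, stack `d` holds the partial sum, `d + 1` the number of rounds left, and `d + 2`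
the number `i` of rounds done. The last of these is the summation variable. The summand is evaluated
on `d + 3` and poured onto `d`. -/
theorem evaluates_sum {loc : ℕ → ℕ} {d : ℕ} (hd : 2 ≤ d) (hloc : ∀ j, loc j < d)
    {b e : InputExpr} (hb : Evaluates (b.compile loc (d + 1)) b loc (d + 1))
    (he : Evaluates (e.compile (scons (d + 2) loc) (d + 3)) e (scons (d + 2) loc) (d + 3)) :
    Evaluates ((sum b e).compile loc d) (sum b e) loc d := by
  obtain ⟨T₁, hb⟩ := hb
  obtain ⟨T₂, he⟩ := he
  refine ⟨T₁ + ((b.bound * (T₂.comp (X + b.bound) + ((2 * e.bound.comp (X + b.bound) + 1) + 1)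
    + 1) + 1) + (2 * b.bound + 1)), fun w ρ L S h => ?_⟩
  have hv := b.val_le h.length_le h.env_le
  set N := b.val w ρ with hN
  set B := b.bound.eval L with hB
  let F : ℕ → ℕ → List Γ' := fun i => update (update (update S d
    (unary (∑ j ∈ range i, e.val w (scons j ρ)))) (d + 1) (unary (N - i))) (d + 2) (unary i)
  have key := runs_loop (k := d + 1) (p := (seq (e.compile (scons (d + 2) loc) (d + 3))
            (seq (pour (d + 3) d fun _ => .bit true) (push (d + 2) fun _ => .bit true)))) F N
    (T₂.eval (L + B) + ((2 * e.bound.eval (L + B) + 1) + 1)) ?_ ?_ ?_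
  · have start : F 0 = update S (d + 1) (unary N) := by
      funext l
      rcases eq_or_ne l d with rfl | hl
      · simp [F, unary_zero, h.free]
      · rcases eq_or_ne l (d + 1) with rfl | hl'
        · simp [F]
        · rcases eq_or_ne l (d + 2) with rfl | hl''
          · simp [F, h.free, unary_zero]
          · simp [F, hl, hl', hl'']
    rw [start] at key
    refine (((hb w ρ L S (h.mono d.le_succ)).seq (key.seq (runs_clear (d + 2) _))).congr ?_).mono ?_
    · funext l
      rcases eq_or_ne l d with rfl | hl
      · simp [val, F, ← hN]
      · rcases eq_or_ne l (d + 1) with rfl | hl'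
        · simp [h.free, unary_zero, F]
        · rcases eq_or_ne l (d + 2) with rfl | hl''
          · simp [h.free]
          · simp [hl, hl', hl'', F]
    · simp only [F, update_self, length_unary, eval_add, eval_mul, eval_ofNat, eval_one, eval_comp,
        eval_X, ← hB]
      gcongr
  · intro i hi
    simpa [head?_unary, F] using hi
  · intro i hi
    have hv' := e.val_le (ρ := scons i ρ) (h.length_le.trans (Nat.le_add_right _ B))
      (scons_le (hi.trans_le hv) h.env_le)
    have e1 : update (F i) (d + 1) (F i (d + 1)).tail = update (update (update S d
        (unary (∑ j ∈ range i, e.val w (scons j ρ)))) (d + 1) (unary (N - (i + 1)))) (d + 2)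
        (unary i) := by
      funext l
      rcases eq_or_ne l (d + 1) with rfl | hl'
      · simp [F, tail_unary, Nat.sub_sub]
      · rcases eq_or_ne l (d + 2) with rfl | hl'' <;> simp [F, *]
    have hrun := (he w (scons i ρ) (L + B) _ (h.bind hd hloc
      (unary (∑ j ∈ range i, e.val w (scons j ρ))) (unary (N - (i + 1))) (hi.trans_le hv))).seq
      ((runs_pour (k := d + 3) (j := d) (by omega) (fun _ => .bit true) _).seq
        (runs_push (d + 2) (.bit true) _))
    obtain ⟨v', t, ht, hx⟩ := hrun (F i (d + 1)).head?
    refine ⟨v', t, ht.trans ?_, ?_⟩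
    · simp only [update_self, length_unary]
      gcongr
    · rw [e1]
      refine hx.congr ?_
      rw [update_self, map_const_eq_unary, length_unary]
      funext l
      rcases eq_or_ne l d with rfl | hl
      · simp [F, sum_range_succ, unary_append, add_comm]
      · rcases eq_or_ne l (d + 1) with rfl | hl'
        · simp [F]
        · rcases eq_or_ne l (d + 2) with rfl | hl''
          · simp [F, unary_succ]
          · rcases eq_or_ne l (d + 3) with rfl | hl'''
            · simp [F, h.free]
            · simp [F, hl, hl', hl'', hl''']
  · simp [unary_zero, F]

/-- The position is counted down on `d + 1` while input symbols move to the scratch stack; then the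
top of the input is inspected and the moved symbols are poured back. -/
theorem evaluates_sym {loc : ℕ → ℕ} {d : ℕ} (hd : 2 ≤ d) {a : Γ'} {e : InputExpr}
    (he : Evaluates (e.compile loc (d + 1)) e loc (d + 1)) :
    Evaluates ((sym a e).compile loc d) (sym a e) loc d := by
  obtain ⟨T, he⟩ := he
  refine ⟨T + ((e.bound * (3 + 1) + 1) + (2 * X + 4)), fun w ρ L S h => ?_⟩
  have hv := e.val_le h.length_le h.env_le
  set N := e.val w ρ with hN
  let F : ℕ → ℕ → List Γ' := fun i => update (update (update S (d + 1) (unary (N - i))) 0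
    (w.drop i)) 1 (w.take i).reverse
  have d0 : 0 ≠ d := by omega
  have d1 : 1 ≠ d := by omega
  have d2 : d ≠ 0 := by omega
  have key := runs_loop (k := d + 1)
    (p := seq (pop 0) (ite Option.isSome (push 1 fun a => a.getD .blank) skip)) F N 3 ?_ ?_ ?_
  · have start : F 0 = update S (d + 1) (unary N) := by
      funext l
      rcases eq_or_ne l 1 with rfl | hl1
      · rw [update_of_ne (by omega), h.scratch]
        simp [F]
      · rcases eq_or_ne l 0 with rfl | hl0
        · simp [F, h.input]
        · rcases eq_or_ne l (d + 1) with rfl | hl <;> simp [F, *]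
    rw [start] at key
    have read : Runs (seq (peek 0) (seq (ite (fun s => decide (s = some a))
        (push d fun _ => .bit true) skip) (pour 1 0 fun a => a.getD .blank))) (F N)
        (update S d (unary ((sym a e).val w ρ))) (2 * L + 4) := by
      have hite : ∃ t ≤ 2, Exec (ite (fun s => decide (s = some a))
          (push d fun _ => .bit true) skip) (F N 0).head? (F N) (F N 0).head?
          (update (F N) d (unary ((sym a e).val w ρ))) t := by
        have hh : (F N 0).head? = w[N]? := by simp [F]
        have hd' : F N d = [] := by simp [F, d2, d1.symm, h.free]
        refine ⟨1 + 1, le_rfl, ?_⟩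
        by_cases hc : w[N]? = some a
        · refine .ite_true _ (by simp [hh, hc]) ((Exec.push d _ _ _).congr ?_)
          rw [hd']
          simp [val, symbolAt, ← hN, hc, unary]
        · refine .ite_false _ (by simp [hh, hc]) ((Exec.skip _ _).congr ?_)
          simp only [val, symbolAt, ← hN, hc, if_false, unary_zero]
          rw [← hd', update_eq_self]
      obtain ⟨t, ht, hite⟩ := hite
      intro v
      obtain ⟨v', t', ht', hp⟩ := runs_pour (k := 1) (j := 0) (by omega) (fun a => a.getD .blank)
        (update (F N) d (unary ((sym a e).val w ρ))) (F N 0).head?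
      refine ⟨v', _, ?_, (Exec.peek 0 v (F N)).seq (hite.seq (hp.congr ?_))⟩
      · have hl : (update (F N) d (unary ((sym a e).val w ρ)) 1).length ≤ L := by
          simp only [update_of_ne d1, F, update_self, List.length_reverse, List.length_take]
          exact (min_le_right _ _).trans h.length_le
        omega
      · funext l
        rcases eq_or_ne l 0 with rfl | hl0
        · simp [F, d0, d1, h.input]
        · rcases eq_or_ne l 1 with rfl | hl1
          · simp [d1, h.scratch]
          · rcases eq_or_ne l d with rfl | hl
            · simp [*]
            · rcases eq_or_ne l (d + 1) with rfl | hl2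
              · simp [F, h.free, unary_zero, d0.symm]
              · simp [F, *]
    refine ((he w ρ L S (h.mono d.le_succ)).seq (key.seq read)).mono ?_
    simp only [eval_add, eval_mul, eval_ofNat, eval_one, eval_X]
    gcongr
  · intro i hi
    simpa [head?_unary, F, d0.symm] using hi
  · intro i hi
    have e1 : update (F i) (d + 1) (F i (d + 1)).tail = update (update (update S (d + 1)
        (unary (N - (i + 1)))) 0 (w.drop i)) 1 (w.take i).reverse := by
      funext l
      rcases eq_or_ne l (d + 1) with rfl | hl'
      · simp [F, tail_unary, Nat.sub_sub, d0.symm]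
      · rcases eq_or_ne l 1 with rfl | hl1
        · rw [update_of_ne hl']
          simp [F]
        · rcases eq_or_ne l 0 with rfl | hl0 <;> simp [F, *]
    rw [e1]
    -- Past the end of the word `pop` reads `none` and nothing is moved, in agreement with `take`
    -- and `drop`, which are then constant in `i`.
    by_cases hw : i < w.length
    · refine ⟨_, (1 + 1) + 1, le_rfl, (Exec.seq (Exec.pop 0 _ _)
        (Exec.ite_true _ ?_ (Exec.push 1 _ _ _))).congr ?_⟩
      · simp [hw]
      · funext l
        rcases eq_or_ne l 1 with rfl | hl1
        · have e2 : w.take (i + 1) = w.take i ++ [w[i]] := by simp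
          simp only [F, update_self]
          rw [e2, List.reverse_append]
          simp [hw]
        · rcases eq_or_ne l 0 with rfl | hl0 <;> simp [F, *]
    · refine ⟨_, (1 + 1) + 1, le_rfl, (Exec.seq (Exec.pop 0 _ _)
        (Exec.ite_false _ ?_ (Exec.skip _ _))).congr ?_⟩
      · simp [hw]
      · push Not at hw
        funext l
        rcases eq_or_ne l 1 with rfl | hl1
        · simp [F, List.take_of_length_le hw, List.take_of_length_le (hw.trans i.le_succ)]
        · rcases eq_or_ne l 0 with rfl | hl0 <;> simp [F, *]
  · simp [unary_zero, F, d0.symm]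

/-- Stacks `0` and `1` are reserved for the input and for scratch work, variables lie strictly
between them and `d`, and subexpressions use only stacks from `d` on; hence no two roles collide. -/
theorem evaluates (e : InputExpr) {loc : ℕ → ℕ} {d : ℕ} (hd : 2 ≤ d)
    (hloc : ∀ j, 2 ≤ loc j ∧ loc j < d) : Evaluates (e.compile loc d) e loc d := by
  have hloc' : ∀ {d'}, d ≤ d' → ∀ j, 2 ≤ loc j ∧ loc j < d' :=
    fun h j => ⟨(hloc j).1, (hloc j).2.trans_le h⟩
  induction e generalizing loc d with
  | one => exact evaluates_one
  | len => exact evaluates_len hd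
  | var j => exact evaluates_var hd hloc j
  | add e₁ e₂ ih₁ ih₂ =>
    exact evaluates_add hd (fun j => (hloc j).2) (ih₁ hd hloc @hloc')
      (ih₂ (by omega) (hloc' d.le_succ) (fun h => hloc' (by omega)))
  | sub e₁ e₂ ih₁ ih₂ =>
    exact evaluates_sub hd (fun j => (hloc j).2) (ih₁ hd hloc @hloc')
      (ih₂ (by omega) (hloc' d.le_succ) (fun h => hloc' (by omega)))
  | mul e₁ e₂ ih₁ ih₂ =>
    exact evaluates_mul hd (fun j => (hloc j).2)
      (ih₁ (by omega) (hloc' d.le_succ) (fun h => hloc' (by omega)))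
      (ih₂ (by omega) (hloc' (by omega)) (fun h => hloc' (by omega)))
  | sum b e ihb ih =>
    have hs : ∀ {d'}, d + 3 ≤ d' → ∀ j, 2 ≤ scons (d + 2) loc j ∧ scons (d + 2) loc j < d' := by
      intro d' h j
      cases j with
      | zero => simp only [scons]; omega
      | succ j => have := hloc j; simp only [scons]; omega
    exact evaluates_sum hd (fun j => (hloc j).2)
      (ihb (by omega) (hloc' d.le_succ) (fun h => hloc' (by omega)))
      (ih (by omega) (hs le_rfl) hs)
  | sym a e ih =>
    exact evaluates_sym hd (ih (by omega) (hloc' d.le_succ) (fun h => hloc' (by omega)))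

end InputExpr

/-! ### Binary output. -/

/-- The successor of a binary number, whose least significant bit comes first. -/
def incBits : List Bool → List Bool
  | [] => [true]
  | false :: l => true :: l
  | true :: l => false :: incBits l

theorem encodePosNum_succ (p : PosNum) :
    Computability.encodePosNum p.succ = incBits (Computability.encodePosNum p) := by
  induction p with
  | one => rfl
  | bit0 p _ => rfl
  | bit1 p ih => exact congrArg (List.cons false) ih

theorem encodeNat_succ (n : ℕ) :
    Computability.encodeNat (n + 1) = incBits (Computability.encodeNat n) := by
  have h : ((n + 1 : ℕ) : Num) = Num.succ (n : Num) := by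
    rw [Nat.cast_succ, Num.add_one]
  rw [Computability.encodeNat, Computability.encodeNat, h]
  rcases (n : Num) with _ | p
  · rfl
  · exact encodePosNum_succ p

theorem length_incBits (l : List Bool) : (incBits l).length ≤ l.length + 1 := by
  induction l with
  | nil => simp [incBits]
  | cons b l ih => cases b <;> simp [incBits, ih]

/-- This crude bound suffices, since the numbers to be converted are already present in unary. -/
theorem length_encodeNat (n : ℕ) : (Computability.encodeNat n).length ≤ n := by
  induction n with
  | zero => rfl
  | succ n ih =>
    rw [encodeNat_succ]
    exact (length_incBits _).trans (by omega)

/-- The carry runs through the maximal initial block of ones. The remainder `r` is empty or starts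
with a zero; `r.tail` covers both cases. -/
theorem exists_incBits_eq (l : List Bool) : ∃ (m : ℕ) (r : List Bool), r.head? ≠ some true ∧
    l = List.replicate m true ++ r ∧ incBits l = List.replicate m false ++ true :: r.tail := by
  induction l with
  | nil => exact ⟨0, [], by simp, rfl, rfl⟩
  | cons b l ih =>
    cases b with
    | false => exact ⟨0, false :: l, by simp, rfl, rfl⟩
    | true =>
      obtain ⟨m, r, hr, h₁, h₂⟩ := ih
      exact ⟨m + 1, r, hr, congrArg (List.cons true) h₁, congrArg (List.cons false) h₂⟩

namespace StackProg

open Function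

/-- Increment the binary number on the stack `o`, with `t` as a scratch stack. -/
def inc (o t : ℕ) : StackProg :=
  seq (loop o (fun a => decide (a = some (.bit true))) (push t fun _ => .bit false))
    (seq (push o fun _ => .bit true) (pour t o fun a => a.getD .blank))

/-- The loop turns the leading ones into zeros on `t`. Its failing test removes the zero that
follows, if there is one; a one takes its place and the zeros are poured back. -/
theorem runs_inc {o t : ℕ} (h : o ≠ t) {S : ℕ → List Γ'} (ht : S t = []) {l : List Bool}
    (ho : S o = l.map .bit) :
    Runs (inc o t) S (update S o ((incBits l).map .bit)) (4 * l.length + 3) := by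
  obtain ⟨m, r, hr, h₁, h₂⟩ := exists_incBits_eq l
  let F : ℕ → ℕ → List Γ' := fun i => update (update S o
    ((List.replicate (m - i) true ++ r).map .bit)) t (List.replicate i (.bit false))
  have hr' : (r.map Γ'.bit).head? ≠ some (.bit true) := by
    rcases r with _ | ⟨b, r⟩
    · simp
    · simpa using hr
  have key := exec_loop (k := o) (b := fun a => decide (a = some (.bit true)))
    (p := push t fun _ => .bit false) F m 1 ?_ ?_ ?_
  · have start : F 0 = S := by
      funext j
      rcases eq_or_ne j t with rfl | hj
      · simp [F, ht]
      · rcases eq_or_ne j o with rfl | hj' <;> simp [F, *]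
    rw [start] at key
    have hl : Runs (loop o (fun a => decide (a = some (.bit true))) (push t fun _ => .bit false)) S
        (update (F m) o (F m o).tail) (m * (1 + 1) + 1) := fun v =>
      let ⟨t, ht, hx⟩ := key v
      ⟨_, t, ht, hx⟩
    refine ((hl.seq ((runs_push o (.bit true) _).seq (runs_pour h.symm
      (fun a => a.getD .blank) _))).congr ?_).mono ?_
    · funext j
      rcases eq_or_ne j o with rfl | hj
      · simp [F, h, h.symm, h₂]
      · rcases eq_or_ne j t with rfl | hj'
        · simp [hj, ht]
        · simp [F, hj, hj']
    · have hm : l.length = m + r.length := by rw [h₁]; simp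
      simp only [F, ne_eq, h.symm, not_false_eq_true, update_of_ne, update_self,
        List.length_replicate]
      omega
  · intro i hi
    obtain ⟨j, hj⟩ : ∃ j, m - i = j + 1 := ⟨m - i - 1, by omega⟩
    simp [F, h, hj, List.replicate_succ]
  · intro i hi
    obtain ⟨j, hj⟩ : ∃ j, m - i = j + 1 := ⟨m - i - 1, by omega⟩
    have hj' : m - (i + 1) = j := by omega
    refine ⟨_, 1, le_rfl, (Exec.push t _ _ _).congr ?_⟩
    funext s
    rcases eq_or_ne s t with rfl | hs
    · simp [F, h.symm, List.replicate_succ]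
    · rcases eq_or_ne s o with rfl | hs'
      · simp [F, hs, hj, hj', List.replicate_succ]
      · simp [F, hs, hs']
  · simpa [F, h] using hr'

/-- Convert the unary number on the stack `k` to binary, on the stack `o`. -/
def toBinary (k o t : ℕ) : StackProg := loop k Option.isSome (inc o t)

theorem runs_toBinary {k o t : ℕ} (hko : k ≠ o) (hkt : k ≠ t) (hot : o ≠ t) {S : ℕ → List Γ'}
    (ht : S t = []) (ho : S o = []) {n : ℕ} (hk : S k = unary n) :
    Runs (toBinary k o t) S
      (update (update S k []) o ((Computability.encodeNat n).map .bit))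
      (n * (4 * n + 3 + 1) + 1) := by
  let F : ℕ → ℕ → List Γ' := fun i => update (update S k (unary (n - i))) o
    ((Computability.encodeNat i).map .bit)
  have key := runs_loop (k := k) (p := inc o t) F n (4 * n + 3) ?_ ?_ ?_
  · have start : F 0 = S := by
      funext j
      rcases eq_or_ne j o with rfl | hj
      · simp only [F, update_self, ho]
        rfl
      · rcases eq_or_ne j k with rfl | hj' <;> simp [F, *]
    rw [start] at key
    refine key.congr ?_
    simp [F, unary_zero]
  · intro i hi
    simpa [head?_unary, F, hko] using hi
  · intro i hi
    obtain ⟨v', s, hs, hx⟩ := runs_inc hot (S := update (F i) k (F i k).tail)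
      (by simp [F, hkt.symm, hot.symm, ht]) (l := Computability.encodeNat i)
      (by simp [F, hko.symm]) (F i k).head?
    refine ⟨v', s, hs.trans ?_, hx.congr ?_⟩
    · have := length_encodeNat i
      omega
    · rw [← encodeNat_succ]
      funext j
      rcases eq_or_ne j o with rfl | hj
      · simp [F]
      · rcases eq_or_ne j k with rfl | hj'
        · simp [F, hj, tail_unary, Nat.sub_sub]
        · simp [F, hj, hj']
  · simp [F, hko, unary_zero]

/-- Prepend the binary representation of the unary number on the stack `k` to the stack `0`. -/
def emit (k : ℕ) : StackProg :=
  seq (toBinary k 6 7) (seq (pour 6 1 fun a => a.getD .blank) (pour 1 0 fun a => a.getD .blank))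

/-- The digits reach stack `0` by way of stack `1`, so that the two reversals cancel. -/
theorem runs_emit {k : ℕ} (hk1 : 1 < k) (hk6 : k < 6) {S : ℕ → List Γ'} (h1 : S 1 = [])
    (h6 : S 6 = []) (h7 : S 7 = []) {n : ℕ} (hk : S k = unary n) :
    Runs (emit k) S (update (update S k []) 0 ((Computability.encodeNat n).map .bit ++ S 0))
      (n * (4 * n + 3 + 1) + 4 * n + 3) := by
  refine (((runs_toBinary (by omega) (by omega) (by omega) h7 h6 hk).seq
    ((runs_pour (by omega) _ _).seq (runs_pour (by omega) _ _))).congr ?_).mono ?_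
  · have k0 : 0 ≠ k := by omega
    have k1 : 1 ≠ k := by omega
    have k6 : 6 ≠ k := by omega
    funext j
    rcases eq_or_ne j 0 with rfl | hj0
    · simp [h1, k0, k1]
    · rcases eq_or_ne j 1 with rfl | hj1
      · simp [k1, h1]
      · rcases eq_or_ne j 6 with rfl | hj6
        · simp [k6, h6]
        · simp [hj0, hj1, hj6]
  · have k1 : 1 ≠ k := by omega
    have := length_encodeNat n
    simp [h1, k1]
    omega

end StackProg

namespace InputExpr

open Function StackProg Polynomial

/-- A program that prints the fraction with sign bit `s`, numerator `p` and denominator `q`. -/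
def printFraction (s p q : InputExpr) : StackProg :=
  seq (s.compile (fun _ => 2) 3) (seq (p.compile (fun _ => 2) 4) (seq (q.compile (fun _ => 2) 5)
    (seq (clear 0) (seq (emit 5) (seq (push 0 fun _ => .comma) (seq (emit 4)
      (seq (pop 3) (ite Option.isSome (push 0 fun _ => .bit true)
        (push 0 fun _ => .bit false)))))))))

/-- Sign, numerator and denominator are evaluated on stacks `3`, `4`, `5` before the input is
erased. The output is built from its end: denominator, comma, numerator, sign. All variables are
located on the empty stack `2`, so they have the value `0`. -/
theorem computableInPolyTime {α : Type} {ea : α → List Γ'} {f : α → ℤ × ℕ} (s p q : InputExpr)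
    (hs : ∀ a, s.val (ea a) (fun _ => 0) = if (f a).1 < 0 then 1 else 0)
    (hp : ∀ a, p.val (ea a) (fun _ => 0) = (f a).1.natAbs)
    (hq : ∀ a, q.val (ea a) (fun _ => 0) = (f a).2) :
    Nonempty (Turing.TM2ComputableInPolyTime ea encodeFraction f) := by
  obtain ⟨T₁, h₁⟩ := s.evaluates (loc := fun _ => 2) (d := 3) (by omega) (fun _ => by omega)
  obtain ⟨T₂, h₂⟩ := p.evaluates (loc := fun _ => 2) (d := 4) (by omega) (fun _ => by omega)
  obtain ⟨T₃, h₃⟩ := q.evaluates (loc := fun _ => 2) (d := 5) (by omega) (fun _ => by omega)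
  refine StackProg.computableInPolyTime (printFraction s p q)
    (T₁ + (T₂ + (T₃ + ((2 * X + 1) + ((q.bound * (4 * q.bound + 3 + 1) + 4 * q.bound + 3) + (1 +
      ((p.bound * (4 * p.bound + 3 + 1) + 4 * p.bound + 3) + 3))))))) (fun a => ?_)
  set w := ea a with hw
  have ready : Ready (fun _ => 2) 3 w (fun _ => 0) w.length (update (fun _ => []) 0 w) :=
    { input := by simp
      scratch := by simp
      env := fun _ => by simp [unary_zero]
      free := fun j hj => by rw [update_of_ne (by omega)]
      length_le := le_rfl
      env_le := fun _ => Nat.zero_le _ }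
  have ready' := ready.update (by omega) (fun _ => by omega) (unary (s.val w fun _ => 0))
  have ready'' := ready'.update (by omega) (fun _ => by omega) (unary (p.val w fun _ => 0))
  have hpb := p.val_le (le_refl w.length) (fun _ => Nat.zero_le w.length)
  have hqb := q.val_le (le_refl w.length) (fun _ => Nat.zero_le w.length)
  let S₁ : ℕ → List Γ' := update (update (fun _ => []) 0 ((Computability.encodeNat
    (f a).1.natAbs).map .bit ++ [.comma] ++ (Computability.encodeNat (f a).2).map .bit)) 3
    (unary (s.val w fun _ => 0))
  have last : Runs (seq (pop 3) (ite Option.isSome (push 0 fun _ => .bit true)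
      (push 0 fun _ => .bit false))) S₁ (update (fun _ => []) 0 (encodeFraction (f a))) 3 := by
    intro v
    have hS : S₁ 3 = unary (if (f a).1 < 0 then 1 else 0) := by simp [S₁, hw, hs]
    have hup : ∀ b : Bool, b = decide ((f a).1 < 0) → update (update S₁ 3 (S₁ 3).tail) 0
        (.bit b :: update S₁ 3 (S₁ 3).tail 0) =
          update (fun _ => []) 0 (encodeFraction (f a)) := by
      intro b hb
      have ht : (S₁ 3).tail = [] := by rw [hS]; split_ifs <;> rfl
      rw [ht]
      funext j
      rcases eq_or_ne j 0 with rfl | hj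
      · simp [S₁, encodeFraction, hb]
      · rcases eq_or_ne j 3 with rfl | hj'
        · simp
        · simp [S₁, hj, hj']
    by_cases hneg : (f a).1 < 0
    · refine ⟨_, _, le_rfl, (Exec.pop 3 _ _).seq (t₂ := 1 + 1) (.ite_true _ ?_
        ((Exec.push 0 _ _ _).congr (hup true (by simp [hneg]))))⟩
      simp [hS, hneg, unary]
    · refine ⟨_, _, le_rfl, (Exec.pop 3 _ _).seq (t₂ := 1 + 1) (.ite_false _ ?_
        ((Exec.push 0 _ _ _).congr (hup false (by simp [hneg]))))⟩
      simp [hS, hneg, unary]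
  have e1 := h₁ w _ _ _ ready
  have e2 := h₂ w _ _ _ ready'
  have e3 := h₃ w _ _ _ ready''
  set ns := s.val w fun _ => 0
  set np := p.val w fun _ => 0 with hnp
  set nq := q.val w fun _ => 0 with hnq
  -- The stacks while the output `l` grows, with sign and numerator still to be printed.
  let S₂ : List Γ' → ℕ → List Γ' := fun l =>
    update (update (update (fun _ => []) 0 l) 3 (unary ns)) 4 (unary np)
  have e4 : Runs (clear 0) (update (S₂ w) 5 (unary nq)) (update (S₂ []) 5 (unary nq))
      (2 * w.length + 1) := by
    refine ((runs_clear 0 _).congr ?_).mono (by simp [S₂])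
    funext j
    rcases eq_or_ne j 0 with rfl | hj <;> simp [S₂, update_apply, *]
  have e5 := (runs_emit (k := 5) (by omega) (by omega) (S := update (S₂ []) 5 (unary nq))
    (by simp [S₂]) (by simp [S₂]) (by simp [S₂]) (n := nq) (by simp)).congr
    (S'' := S₂ ((Computability.encodeNat nq).map .bit)) (by
      funext j
      rcases eq_or_ne j 0 with rfl | hj
      · simp [S₂]
      · rcases eq_or_ne j 5 with rfl | hj' <;> simp [S₂, update_apply, *])
  have e6 := (runs_push 0 .comma (S₂ ((Computability.encodeNat nq).map .bit))).congr
    (S'' := S₂ (.comma :: (Computability.encodeNat nq).map .bit)) (by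
      funext j
      rcases eq_or_ne j 0 with rfl | hj <;> simp [S₂, update_apply, *])
  have e7 := (runs_emit (k := 4) (by omega) (by omega)
    (S := S₂ (.comma :: (Computability.encodeNat nq).map .bit))
    (by simp [S₂]) (by simp [S₂]) (by simp [S₂]) (n := np) (by simp [S₂])).congr
    (S'' := S₁) (by
      funext j
      rcases eq_or_ne j 0 with rfl | hj
      · simp [S₁, S₂, hnp, hnq, hw, hp, hq]
      · rcases eq_or_ne j 4 with rfl | hj'
        · simp [S₁]
        · rcases eq_or_ne j 3 with rfl | hj3
          · simp [S₁, S₂, ns]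
          · simp [S₁, S₂, hj, hj', hj3])
  refine (e1.seq (e2.seq (e3.seq (e4.seq (e5.seq (e6.seq (e7.seq last))))))).mono ?_
  simp only [eval_add, eval_mul, eval_ofNat, eval_one, eval_X]
  gcongr

end InputExpr

/-! ### Edge weights as sums over ordered pairs. -/

/-- The label of the edge `st`, and `0` if `s = t`. -/
def edgeLabel {n : ℕ} (c : KEdge n → ℤ) (s t : Fin n) : ℤ :=
  if h : s ≠ t then c ⟨s(s, t), by simpa using h⟩ else 0

theorem edgeLabel_self {n : ℕ} (c : KEdge n → ℤ) (s : Fin n) : edgeLabel c s s = 0 := by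
  simp [edgeLabel]

theorem edgeLabel_comm {n : ℕ} (c : KEdge n → ℤ) (s t : Fin n) :
    edgeLabel c s t = edgeLabel c t s := by
  unfold edgeLabel
  by_cases h : s = t
  · subst h; rfl
  · simp only [ne_eq, h, Ne.symm h, not_false_eq_true, dif_pos, Sym2.eq_swap (a := s)]

theorem edgeLabel_of_eq {n : ℕ} (c : KEdge n → ℤ) {s t : Fin n} {e : KEdge n}
    (h : s(s, t) = (e : Sym2 (Fin n))) : edgeLabel c s t = c e := by
  obtain ⟨e, he⟩ := e
  subst h
  have : s ≠ t := by simpa using he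
  simp [edgeLabel, this]

/-- Makes every weight formula a counting formula as well; hence labels are arbitrary integers in
these lemmas. -/
theorem card_eq_weight_one {n : ℕ} (E : Finset (KEdge n)) : (#E : ℤ) = weight (fun _ => 1) E := by
  simp [weight]

theorem edgeLabel_one {n : ℕ} (s t : Fin n) :
    edgeLabel (fun _ => 1) s t = if s ≠ t then 1 else 0 := by
  simp [edgeLabel]

open scoped Classical in
-- Each edge comes from exactly two ordered pairs, and diagonal pairs contribute nothing because
-- their label is `0`.
theorem two_mul_weight {n : ℕ} (c : KEdge n → ℤ) (E : Finset (KEdge n))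
    (Q : Sym2 (Fin n) → Prop) (hE : ∀ e, e ∈ E ↔ Q e) :
    2 * weight c E = ∑ s, ∑ t, if Q s(s, t) then edgeLabel c s t else 0 := by
  obtain rfl : E = univ.filter fun e : KEdge n => Q e := by ext e; simp [hE]
  have fiber : ∀ e : KEdge n, ∑ p : Fin n × Fin n with s(p.1, p.2) = (e : Sym2 (Fin n)),
      (if Q s(p.1, p.2) then edgeLabel c p.1 p.2 else 0) = 2 * if Q e then c e else 0 := by
    intro e
    rw [sum_congr rfl (g := fun _ => if Q e then c e else 0)]
    · obtain ⟨e, he⟩ := e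
      induction e with | _ a b
      have hab : a ≠ b := by simpa using he
      have : ({p : Fin n × Fin n | s(p.1, p.2) = s(a, b)} : Finset _) = {(a, b), (b, a)} := by
        ext ⟨s, t⟩
        simp
      rw [this, sum_pair (by simp [hab]), two_mul]
    · intro p hp
      rw [mem_filter] at hp
      rw [hp.2, edgeLabel_of_eq c hp.2]
  rw [weight, sum_filter, mul_sum, ← Fintype.sum_prod_type']
  simp_rw [← fiber]
  simp_rw [sum_filter]
  rw [sum_comm]
  refine sum_congr rfl fun p _ => ?_
  by_cases h : p.1 = p.2
  · simp [h, edgeLabel_self]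
  · rw [Fintype.sum_eq_single (⟨s(p.1, p.2), by simpa using h⟩ : KEdge n)
      fun e he => if_neg fun h' => he (Subtype.ext h'.symm), if_pos rfl]

theorem two_mul_weight_edgesWithin_top {n : ℕ} (c : KEdge n → ℤ) (S : Finset (Fin n)) :
    2 * weight c (edgesWithin ⊤ S) = ∑ s ∈ S, ∑ t ∈ S, edgeLabel c s t := by
  classical
  rw [two_mul_weight c _ (fun e => ∀ v ∈ e, v ∈ S) (fun e => by
    simpa [edgesWithin] using fun _ => e.2), ← sum_subset (subset_univ S)]
  · refine sum_congr rfl fun s hs => ?_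
    rw [← sum_subset (subset_univ S)]
    · exact sum_congr rfl fun t ht => if_pos (by simp [hs, ht])
    · intro t _ ht
      simp [ht]
  · intro s _ hs
    simp [hs]

theorem two_mul_card_edgesWithin_top {n : ℕ} (S : Finset (Fin n)) :
    2 * #(edgesWithin (⊤ : SimpleGraph (Fin n)) S) = #S * #S - #S := by
  have h := two_mul_weight_edgesWithin_top (fun _ => 1) S
  simp only [edgeLabel_one, ← card_eq_weight_one] at h
  rw [← offDiag_card]
  have h' : ((#S.offDiag : ℕ) : ℤ) = ∑ s ∈ S, ∑ t ∈ S, if s ≠ t then 1 else 0 := by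
    rw [← sum_product', ← sum_filter, sum_const, nsmul_one]
    congr 2
    ext p
    simp [and_assoc]
  exact_mod_cast h.trans h'.symm

theorem weight_edgesLeaving {n : ℕ} (c : KEdge n → ℤ) {a : Fin n} {S : Finset (Fin n)}
    (ha : a ∈ S) : weight c (edgesLeaving a S) = ∑ l ∈ Sᶜ, edgeLabel c a l := by
  have hne : ∀ l ∈ Sᶜ, a ≠ l := fun l hl h => mem_compl.mp hl (h ▸ ha)
  symm
  refine sum_bij (fun l hl => ⟨s(a, l), by simpa using hne l hl⟩) ?_ ?_ ?_ ?_
  · intro l hl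
    simp only [edgesLeaving, mem_filter, mem_univ, true_and]
    exact ⟨l, mem_compl.mp hl, rfl⟩
  · intro l hl l' hl' h
    have h' : s(a, l) = s(a, l') := congrArg Subtype.val h
    exact Sym2.congr_right.mp h'
  · rintro ⟨e, he⟩ h
    simp only [edgesLeaving, mem_filter, mem_univ, true_and] at h
    obtain ⟨l, hl, rfl⟩ := h
    exact ⟨l, mem_compl.mpr hl, rfl⟩
  · intro l hl
    exact edgeLabel_of_eq c rfl

theorem card_edgesLeaving {n : ℕ} {a : Fin n} {S : Finset (Fin n)} (ha : a ∈ S) :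
    #(edgesLeaving a S) = #Sᶜ := by
  have h := weight_edgesLeaving (fun _ => 1) ha
  rw [← card_eq_weight_one, sum_congr rfl (g := fun _ => 1), sum_const, nsmul_one] at h
  · exact_mod_cast h
  · intro l hl
    rw [edgeLabel_one, if_pos]
    exact fun h => mem_compl.mp hl (h ▸ ha)

theorem uniformCondExp_eq {Ω : Type} [Fintype Ω] [DecidableEq Ω] [Nonempty Ω] (X : Ω → ℚ)
    (A : Finset Ω) : uniformCondExp X A = (∑ ω ∈ A, X ω) / #A := by
  have : (Fintype.card Ω : ℚ) ≠ 0 := by simp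
  rw [uniformCondExp, Fintype.expect_eq_sum_div_card, Fintype.expect_eq_sum_div_card,
    div_div_div_cancel_right₀ this, ← sum_filter, ← sum_filter]
  simp

/-! ### Permutations with a prescribed prefix and the conditional expectation. -/

namespace EmbeddingInput

variable (x : EmbeddingInput)

theorem mem_firstK {v : Fin x.n} : v ∈ x.firstK ↔ v.val < x.k := by simp [firstK]

theorem pos_mem_firstK (j : Fin x.k) : x.pos j ∈ x.firstK := by
  simp [mem_firstK, pos]

theorem exists_pos_eq {v : Fin x.n} (hv : v ∈ x.firstK) : ∃ j, x.pos j = v :=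
  ⟨⟨v, x.mem_firstK.mp hv⟩, rfl⟩

theorem pos_injective : Function.Injective x.pos := Fin.castLE_injective x.k_le

theorem firstK_eq_image : x.firstK = univ.image x.pos := by
  ext v
  simp only [mem_image, mem_univ, true_and]
  exact ⟨fun h => x.exists_pos_eq h, by rintro ⟨j, rfl⟩; exact x.pos_mem_firstK j⟩

theorem card_firstK : #x.firstK = x.k := by
  rw [firstK_eq_image, card_image_of_injective _ x.pos_injective, card_fin]

theorem card_used : #x.used = x.k := by
  rw [used, card_image_of_injective _ x.i_inj, card_fin]

theorem mem_event {π : Equiv.Perm (Fin x.n)} : π ∈ x.event ↔ ∀ j, π (x.pos j) = x.i j := by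
  simp [event]

theorem event_nonempty : x.event.Nonempty := by
  let e := (Equiv.ofInjective _ x.pos_injective).symm.trans (Equiv.ofInjective _ x.i_inj)
  refine ⟨e.extendSubtype, x.mem_event.mpr fun j => ?_⟩
  have : (⟨x.pos j, Set.mem_range_self j⟩ : Set.range x.pos) =
      Equiv.ofInjective _ x.pos_injective j := rfl
  rw [Equiv.extendSubtype_apply_of_mem e _ (Set.mem_range_self j), this]
  simp [e]

theorem mem_used_iff {π : Equiv.Perm (Fin x.n)} (hπ : π ∈ x.event) {v : Fin x.n} :
    π v ∈ x.used ↔ v ∈ x.firstK := by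
  rw [mem_event] at hπ
  simp only [used, mem_image, mem_univ, true_and]
  constructor
  · rintro ⟨j, hj⟩
    rw [← hπ] at hj
    rw [← π.injective hj]
    exact x.pos_mem_firstK j
  · intro h
    obtain ⟨j, rfl⟩ := x.exists_pos_eq h
    exact ⟨j, (hπ j).symm⟩

/-- The event is a coset of the pointwise stabilizer of the first `k` positions, which is the
symmetric group on the remaining ones. -/
theorem card_event : #x.event = (x.n - x.k)! := by
  obtain ⟨π₀, hπ₀⟩ := x.event_nonempty
  have key : #x.event =
      -- The double negation matches `Equiv.Perm.subtypeEquivSubtypePerm` for the predicate of not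
      -- being in `firstK`.
      Fintype.card {σ : Equiv.Perm (Fin x.n) // ∀ v, ¬ v ∉ x.firstK → σ v = v} := by
    rw [← Fintype.card_coe]
    refine Fintype.card_congr ((Equiv.mulLeft π₀⁻¹).subtypeEquiv fun π => ?_)
    rw [mem_event] at hπ₀ ⊢
    constructor
    · intro h v hv
      obtain ⟨j, rfl⟩ := x.exists_pos_eq (not_not.mp hv)
      simp [h, ← hπ₀]
    · intro h j
      have := h (x.pos j) (not_not.mpr (x.pos_mem_firstK j))
      rw [← hπ₀ j]
      exact Equiv.Perm.inv_eq_iff_eq.mp this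
  rw [key, ← Fintype.card_congr (Equiv.Perm.subtypeEquivSubtypePerm _), Fintype.card_perm,
    Fintype.card_subtype_compl, Fintype.card_fin, Fintype.card_coe, card_firstK]

/-- The positions that cannot be distinguished from `u` by permutations that fix the first `k`
positions. -/
def orbit (u : Fin x.n) : Finset (Fin x.n) := if u ∈ x.firstK then {u} else x.firstKᶜ

/-- The possible images of `u` under the permutations in the event. -/
def slot (u : Fin x.n) : Finset (Fin x.n) :=
  if h : u ∈ x.firstK then {x.i ⟨u, x.mem_firstK.mp h⟩} else x.usedᶜ

theorem mem_orbit_self (u : Fin x.n) : u ∈ x.orbit u := by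
  unfold orbit
  split_ifs with h <;> simp [h]

theorem apply_mem_slot {π : Equiv.Perm (Fin x.n)} (hπ : π ∈ x.event) {u v : Fin x.n} :
    π v ∈ x.slot u ↔ v ∈ x.orbit u := by
  unfold slot orbit
  split_ifs with h
  · rw [mem_singleton, mem_singleton, ← x.mem_event.mp hπ, π.injective.eq_iff]
    rfl
  · rw [mem_compl, mem_compl, x.mem_used_iff hπ]

/-- The pairs of positions that cannot be distinguished from `(u, v)` by permutations that fix the
first `k` positions. -/
def orbitPairs (u v : Fin x.n) : Finset (Fin x.n × Fin x.n) :=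
  {p ∈ x.orbit u ×ˢ x.orbit v | p.1 ≠ p.2}

/-- The possible images of `(u, v)` under the permutations in the event. -/
def slotPairs (u v : Fin x.n) : Finset (Fin x.n × Fin x.n) :=
  {p ∈ x.slot u ×ˢ x.slot v | p.1 ≠ p.2}

theorem swap_fixes {u u' v : Fin x.n} (h : u' ∈ x.orbit u) (hv : v ∈ x.firstK) :
    Equiv.swap u u' v = v := by
  unfold orbit at h
  split_ifs at h with hu
  · rw [mem_singleton.mp h, Equiv.swap_self]
    rfl
  · exact Equiv.swap_apply_of_ne_of_ne (fun e => hu (e ▸ hv))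
      (fun e => mem_compl.mp h (e ▸ hv))

/-- Two transpositions suffice: the first takes `u` to `u'`, the second takes the current image of
`v` to `v'`. The second leaves `u'` alone because `u ≠ v` and `u' ≠ v'`. -/
theorem exists_perm_of_mem_orbitPairs {u v u' v' : Fin x.n} (huv : u ≠ v)
    (h : (u', v') ∈ x.orbitPairs u v) : ∃ τ : Equiv.Perm (Fin x.n),
      (∀ w ∈ x.firstK, τ w = w) ∧ τ u = u' ∧ τ v = v' := by
  simp only [orbitPairs, mem_filter, mem_product] at h
  obtain ⟨⟨hu, hv⟩, hne⟩ := h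
  have h1 : v' ∈ x.orbit (Equiv.swap u u' v) := by
    by_cases hv0 : v ∈ x.firstK
    · rwa [x.swap_fixes hu hv0]
    · have : Equiv.swap u u' v ∉ x.firstK := by
        intro hmem
        have := x.swap_fixes hu hmem
        rw [Equiv.swap_apply_self] at this
        exact hv0 (this ▸ hmem)
      simp only [orbit, hv0, this, if_false] at hv ⊢
      exact hv
  refine ⟨Equiv.swap (Equiv.swap u u' v) v' * Equiv.swap u u', ?_, ?_, ?_⟩
  · intro w hw
    rw [Equiv.Perm.mul_apply, x.swap_fixes hu hw, x.swap_fixes h1 hw]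
  · rw [Equiv.Perm.mul_apply, Equiv.swap_apply_left]
    exact Equiv.swap_apply_of_ne_of_ne (fun e => huv ((Equiv.swap u u').injective
      ((Equiv.swap_apply_left u u').trans e))) hne
  · rw [Equiv.Perm.mul_apply, Equiv.swap_apply_left]

theorem sum_event_eq {u v u' v' : Fin x.n} (huv : u ≠ v) (h : (u', v') ∈ x.orbitPairs u v)
    (g : Fin x.n → Fin x.n → ℚ) :
    ∑ π ∈ x.event, g (π u') (π v') = ∑ π ∈ x.event, g (π u) (π v) := by
  obtain ⟨τ, hτ, rfl, rfl⟩ := x.exists_perm_of_mem_orbitPairs huv h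
  refine sum_equiv (Equiv.mulRight τ) (fun π => ?_) (fun π _ => rfl)
  rw [mem_event, mem_event]
  refine forall_congr' fun j => ?_
  rw [Equiv.coe_mulRight, Equiv.Perm.mul_apply, hτ _ (x.pos_mem_firstK j)]

/-- Double counting: the sum over the event is the same for all pairs in the orbit, and for each
fixed `π` the orbit pairs run bijectively through the slot pairs. Thus `(π u, π v)` is uniform on
`slotPairs u v`. -/
theorem card_orbitPairs_mul_sum {u v : Fin x.n} (huv : u ≠ v) (g : Fin x.n → Fin x.n → ℚ) :
    (#(x.orbitPairs u v) : ℚ) * ∑ π ∈ x.event, g (π u) (π v) =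
      #x.event * ∑ p ∈ x.slotPairs u v, g p.1 p.2 := by
  calc (#(x.orbitPairs u v) : ℚ) * ∑ π ∈ x.event, g (π u) (π v)
      = ∑ p ∈ x.orbitPairs u v, ∑ π ∈ x.event, g (π p.1) (π p.2) := by
        rw [← nsmul_eq_mul, ← sum_const]
        exact sum_congr rfl fun p hp => (x.sum_event_eq huv hp g).symm
    _ = ∑ π ∈ x.event, ∑ p ∈ x.orbitPairs u v, g (π p.1) (π p.2) := sum_comm
    _ = ∑ π ∈ x.event, ∑ p ∈ x.slotPairs u v, g p.1 p.2 := by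
        refine sum_congr rfl fun π hπ => ?_
        refine sum_equiv (π.prodCongr π) (fun p => ?_) (fun _ _ => rfl)
        simp [orbitPairs, slotPairs, x.apply_mem_slot hπ]
    _ = #x.event * ∑ p ∈ x.slotPairs u v, g p.1 p.2 := by rw [sum_const, nsmul_eq_mul]

theorem orbitPairs_nonempty {u v : Fin x.n} (huv : u ≠ v) : (x.orbitPairs u v).Nonempty :=
  ⟨(u, v), by simp [orbitPairs, x.mem_orbit_self, huv]⟩

open scoped Classical in
theorem two_mul_weight_copy (π : Equiv.Perm (Fin x.n)) (P : Fin x.n → Prop) (S : Finset (Fin x.n))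
    (hP : ∀ v, π v ∈ S ↔ P v) :
    2 * weight x.c (edgesWithin (x.copy π) S) =
      ∑ u, ∑ v, if x.F.Adj u v ∧ P u ∧ P v then edgeLabel x.c (π u) (π v) else 0 := by
  rw [two_mul_weight x.c _ (fun e => e ∈ (x.copy π).edgeSet ∧ ∀ v ∈ e, v ∈ S)
    (by simp [edgesWithin]), ← Equiv.sum_comp π]
  refine sum_congr rfl fun u _ => ?_
  rw [← Equiv.sum_comp π]
  refine sum_congr rfl fun v _ => ?_
  have : (x.copy π).Adj (π u) (π v) ↔ x.F.Adj u v :=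
    SimpleGraph.map_adj_apply (f := π.toEmbedding)
  simp [this, ← hP]

open scoped Classical in
theorem two_mul_weight_copy_univ (π : Equiv.Perm (Fin x.n)) :
    2 * weight x.c (edgesOf (x.copy π)) =
      ∑ u, ∑ v, if x.F.Adj u v then edgeLabel x.c (π u) (π v) else 0 := by
  have h := x.two_mul_weight_copy π (fun _ => True) univ (by simp)
  simp only [and_true] at h
  rw [← h]
  simp [edgesWithin, edgesOf]

theorem condExpWeight_eq :
    x.condExpWeight = (∑ π ∈ x.event, (weight x.c (edgesOf (x.copy π)) : ℚ)) / #x.event :=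
  uniformCondExp_eq _ _

open scoped Classical in
/-- The conditional expectation as a sum over the ordered edges of `F` of the average label over
the possible images. -/
theorem two_mul_condExpWeight :
    2 * x.condExpWeight = ∑ u, ∑ v, if x.F.Adj u v then
      (∑ p ∈ x.slotPairs u v, (edgeLabel x.c p.1 p.2 : ℚ)) / #(x.orbitPairs u v) else 0 := by
  have h0 : (#x.event : ℚ) ≠ 0 := by simpa using x.event_nonempty.ne_empty
  have h2 : ∀ π, (2 : ℚ) * (weight x.c (edgesOf (x.copy π)) : ℚ) =
      ∑ u, ∑ v, if x.F.Adj u v then (edgeLabel x.c (π u) (π v) : ℚ) else 0 := by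
    intro π
    have := congrArg (Int.cast (R := ℚ)) (x.two_mul_weight_copy_univ π)
    push_cast at this
    exact this
  rw [condExpWeight_eq, mul_div_assoc', mul_sum, div_eq_iff h0, sum_congr rfl fun π _ => h2 π,
    sum_comm, sum_mul]
  refine sum_congr rfl fun u _ => ?_
  rw [sum_comm, sum_mul]
  refine sum_congr rfl fun v _ => ?_
  split_ifs with hadj
  · have h1 : (#(x.orbitPairs u v) : ℚ) ≠ 0 := by
      simpa using (x.orbitPairs_nonempty hadj.ne).ne_empty
    have := x.card_orbitPairs_mul_sum hadj.ne fun s t => (edgeLabel x.c s t : ℚ)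
    rw [div_mul_eq_mul_div, eq_div_iff h1]
    linarith
  · simp

theorem card_firstK_compl : #x.firstKᶜ = x.n - x.k := by
  rw [card_compl, card_firstK, Fintype.card_fin]

theorem card_used_compl : #x.usedᶜ = x.n - x.k := by
  rw [card_compl, card_used, Fintype.card_fin]

theorem slot_eq_of_mem {π : Equiv.Perm (Fin x.n)} (hπ : π ∈ x.event) {u : Fin x.n}
    (hu : u ∈ x.firstK) : x.slot u = {π u} := by
  obtain ⟨j, rfl⟩ := x.exists_pos_eq hu
  rw [slot, dif_pos hu, x.mem_event.mp hπ]
  rfl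

theorem slot_eq_of_notMem {u : Fin x.n} (hu : u ∉ x.firstK) : x.slot u = x.usedᶜ :=
  dif_neg hu

theorem orbit_eq_of_mem {u : Fin x.n} (hu : u ∈ x.firstK) : x.orbit u = {u} := if_pos hu

theorem orbit_eq_of_notMem {u : Fin x.n} (hu : u ∉ x.firstK) : x.orbit u = x.firstKᶜ := if_neg hu

theorem orbitPairs_comm (u v : Fin x.n) : #(x.orbitPairs u v) = #(x.orbitPairs v u) := by
  refine card_bij (fun p _ => p.swap) ?_ ?_ ?_
  · rintro ⟨a, b⟩ h
    simp only [orbitPairs, mem_filter, mem_product, Prod.swap] at h ⊢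
    exact ⟨h.1.symm, h.2.symm⟩
  · rintro ⟨a, b⟩ _ ⟨a', b'⟩ _ h
    simpa [and_comm] using h
  · rintro ⟨a, b⟩ h
    simp only [orbitPairs, mem_filter, mem_product] at h
    exact ⟨(b, a), by simp [orbitPairs, h.1.1, h.1.2, Ne.symm h.2], rfl⟩

theorem sum_slotPairs_comm (u v : Fin x.n) :
    ∑ p ∈ x.slotPairs u v, edgeLabel x.c p.1 p.2 =
      ∑ p ∈ x.slotPairs v u, edgeLabel x.c p.1 p.2 := by
  refine sum_equiv (Equiv.prodComm _ _) ?_ fun p _ => edgeLabel_comm _ _ _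
  rintro ⟨a, b⟩
  simp [slotPairs, and_comm, eq_comm]

theorem sum_slotPairs (u v : Fin x.n) : ∑ p ∈ x.slotPairs u v, edgeLabel x.c p.1 p.2 =
    ∑ s ∈ x.slot u, ∑ t ∈ x.slot v, edgeLabel x.c s t := by
  rw [slotPairs, ← sum_product', sum_filter]
  refine sum_congr rfl fun p _ => ?_
  split_ifs with h
  · rfl
  · rw [not_not.mp h, edgeLabel_self]

theorem card_orbitPairs_mem_mem {u v : Fin x.n} (huv : u ≠ v) (hu : u ∈ x.firstK)
    (hv : v ∈ x.firstK) : #(x.orbitPairs u v) = 1 := by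
  rw [orbitPairs, x.orbit_eq_of_mem hu, x.orbit_eq_of_mem hv, filter_true_of_mem]
  · simp
  · simpa using huv

theorem card_orbitPairs_mem_notMem {u v : Fin x.n} (hu : u ∈ x.firstK) (hv : v ∉ x.firstK) :
    #(x.orbitPairs u v) = x.n - x.k := by
  rw [orbitPairs, x.orbit_eq_of_mem hu, x.orbit_eq_of_notMem hv, filter_true_of_mem]
  · rw [card_product, card_singleton, one_mul, card_firstK_compl]
  · rintro ⟨a, b⟩ h
    rw [mem_product, mem_singleton, mem_compl] at h
    exact fun e => h.2 (e ▸ h.1.symm ▸ hu)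

theorem card_orbitPairs_notMem_notMem {u v : Fin x.n} (hu : u ∉ x.firstK) (hv : v ∉ x.firstK) :
    #(x.orbitPairs u v) = (x.n - x.k) * (x.n - x.k) - (x.n - x.k) := by
  rw [orbitPairs, x.orbit_eq_of_notMem hu, x.orbit_eq_of_notMem hv, ← card_firstK_compl,
    ← offDiag_card]
  congr 1
  ext p
  simp [and_assoc]

open scoped Classical in
-- The slot of a position among the first `k` is a single vertex, and that of any other position is
-- the set of unoccupied vertices. So the average over slot pairs is a label, the mean over the
-- edges leaving an occupied vertex, or the mean over the unoccupied part, according to the ends of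
-- the edge.
theorem condExpWeight_eq_explicit {π : Equiv.Perm (Fin x.n)} (hπ : π ∈ x.event) :
    x.condExpWeight =
      (weight x.c (edgesWithin (x.copy π) x.used) : ℚ)
      + ∑ j : Fin x.k, avgWeight x.c (edgesLeaving (x.i j) x.used) *
          ((x.F.neighborSet (x.pos j) \ (x.firstK : Set (Fin x.n))).ncard : ℚ)
      + avgWeight x.c (edgesWithin ⊤ x.usedᶜ) * (#(edgesWithin x.F x.firstKᶜ) : ℚ) := by
  have two : ∀ {a b : ℚ}, 2 * a = 2 * b → a = b := fun h => by linarith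
  apply two
  have hinner : (2 : ℚ) * weight x.c (edgesWithin (x.copy π) x.used) =
      ∑ u, ∑ v, if x.F.Adj u v ∧ u ∈ x.firstK ∧ v ∈ x.firstK then
        (edgeLabel x.c (π u) (π v) : ℚ) else 0 := by
    have := congrArg (Int.cast (R := ℚ)) (x.two_mul_weight_copy π (· ∈ x.firstK) x.used
      fun v => x.mem_used_iff hπ)
    push_cast at this
    exact this
  have houter : (2 : ℚ) * #(edgesWithin x.F x.firstKᶜ) =
      ∑ u, ∑ v, if x.F.Adj u v ∧ u ∉ x.firstK ∧ v ∉ x.firstK then (1 : ℚ) else 0 := by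
    have := congrArg (Int.cast (R := ℚ)) (two_mul_weight (n := x.n) (fun _ => 1)
      (edgesWithin x.F x.firstKᶜ) (fun e => e ∈ x.F.edgeSet ∧ ∀ v ∈ e, v ∈ x.firstKᶜ)
      (by simp [edgesWithin]))
    rw [← card_eq_weight_one] at this
    push_cast at this
    rw [this]
    refine sum_congr rfl fun u _ => sum_congr rfl fun v _ => ?_
    by_cases h : x.F.Adj u v
    · simp [h, edgeLabel_one, h.ne]
    · simp [h]
  have hcross : ∑ j : Fin x.k, avgWeight x.c (edgesLeaving (x.i j) x.used) *
        ((x.F.neighborSet (x.pos j) \ (x.firstK : Set (Fin x.n))).ncard : ℚ) =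
      ∑ u, ∑ v, if x.F.Adj u v ∧ u ∈ x.firstK ∧ v ∉ x.firstK then
        avgWeight x.c (edgesLeaving (π u) x.used) else 0 := by
    have hrow : ∀ u, (∑ v, if x.F.Adj u v ∧ u ∈ x.firstK ∧ v ∉ x.firstK then
        avgWeight x.c (edgesLeaving (π u) x.used) else 0) = if u ∈ x.firstK then
        avgWeight x.c (edgesLeaving (π u) x.used) *
          ((x.F.neighborSet u \ (x.firstK : Set (Fin x.n))).ncard : ℚ) else 0 := by
      intro u
      by_cases hu : u ∈ x.firstK
      · have hset : (x.F.neighborSet u \ (x.firstK : Set (Fin x.n))) =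
            (({v | x.F.Adj u v ∧ v ∉ x.firstK} : Finset (Fin x.n)) : Set (Fin x.n)) := by
          ext v
          simp
        rw [if_pos hu, hset, Set.ncard_coe_finset, ← sum_filter, sum_const, nsmul_eq_mul, mul_comm]
        simp [hu]
      · simp [hu]
    rw [sum_congr rfl fun u _ => hrow u, ← sum_filter, filter_mem_eq_inter, univ_inter,
      firstK_eq_image, sum_image fun _ _ _ _ h => x.pos_injective h, ← firstK_eq_image]
    exact sum_congr rfl fun j _ => by rw [x.mem_event.mp hπ]
  -- Reversing the ordered edges exchanges the two mixed classes, which supplies the factor two for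
  -- the middle term.
  have hcross' : ∑ u, ∑ v, (if x.F.Adj u v ∧ u ∈ x.firstK ∧ v ∉ x.firstK then
        avgWeight x.c (edgesLeaving (π u) x.used) else 0) =
      ∑ u, ∑ v, if x.F.Adj u v ∧ u ∉ x.firstK ∧ v ∈ x.firstK then
        avgWeight x.c (edgesLeaving (π v) x.used) else 0 := by
    rw [sum_comm]
    refine sum_congr rfl fun u _ => sum_congr rfl fun v _ => ?_
    simp only [x.F.adj_comm v u, and_comm (a := v ∈ x.firstK)]
  have hleave : ∀ {u v}, u ∈ x.firstK → v ∉ x.firstK →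
      (∑ p ∈ x.slotPairs u v, (edgeLabel x.c p.1 p.2 : ℚ)) / #(x.orbitPairs u v) =
        avgWeight x.c (edgesLeaving (π u) x.used) := by
    intro u v hu hv
    have hm := (x.mem_used_iff hπ).mpr hu
    rw [avgWeight, card_edgesLeaving hm, weight_edgesLeaving _ hm, card_used_compl,
      x.card_orbitPairs_mem_notMem hu hv, ← Int.cast_sum, x.sum_slotPairs, x.slot_eq_of_mem hπ hu,
      x.slot_eq_of_notMem hv, sum_singleton]
  have hpoint : ∀ u v, (if x.F.Adj u v then
      (∑ p ∈ x.slotPairs u v, (edgeLabel x.c p.1 p.2 : ℚ)) / #(x.orbitPairs u v) else 0) =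
      (if x.F.Adj u v ∧ u ∈ x.firstK ∧ v ∈ x.firstK then (edgeLabel x.c (π u) (π v) : ℚ) else 0) +
      (if x.F.Adj u v ∧ u ∈ x.firstK ∧ v ∉ x.firstK then
        avgWeight x.c (edgesLeaving (π u) x.used) else 0) +
      (if x.F.Adj u v ∧ u ∉ x.firstK ∧ v ∈ x.firstK then
        avgWeight x.c (edgesLeaving (π v) x.used) else 0) +
      avgWeight x.c (edgesWithin ⊤ x.usedᶜ) *
        (if x.F.Adj u v ∧ u ∉ x.firstK ∧ v ∉ x.firstK then 1 else 0) := by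
    intro u v
    by_cases hadj : x.F.Adj u v
    swap
    · simp [hadj]
    by_cases hu : u ∈ x.firstK <;> by_cases hv : v ∈ x.firstK
    · simp only [hadj, hu, hv, not_true_eq_false, and_true, and_false, and_self, if_true, if_false,
        add_zero, mul_zero]
      rw [x.card_orbitPairs_mem_mem hadj.ne hu hv, ← Int.cast_sum, x.sum_slotPairs,
        x.slot_eq_of_mem hπ hu, x.slot_eq_of_mem hπ hv, sum_singleton, sum_singleton]
      simp
    · simp only [hadj, hu, hv, not_true_eq_false, not_false_eq_true, and_true, and_false,
        and_self, if_true, if_false, add_zero, mul_zero, zero_add]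
      exact hleave hu hv
    · simp only [hadj, hu, hv, not_true_eq_false, not_false_eq_true, and_true, and_false,
        and_self, if_true, if_false, add_zero, mul_zero, zero_add]
      rw [orbitPairs_comm, ← Int.cast_sum, sum_slotPairs_comm, Int.cast_sum]
      exact hleave hv hu
    · simp only [hadj, hu, hv, not_false_eq_true, and_true, and_false,
        and_self, if_true, if_false, mul_one, zero_add]
      rw [x.card_orbitPairs_notMem_notMem hu hv, ← card_used_compl, ← two_mul_card_edgesWithin_top,
        ← Int.cast_sum, x.sum_slotPairs, x.slot_eq_of_notMem hu, x.slot_eq_of_notMem hv,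
        ← two_mul_weight_edgesWithin_top, avgWeight]
      push_cast
      -- Numerator and denominator both count each edge in two orders.
      exact mul_div_mul_left _ _ two_ne_zero
  rw [two_mul_condExpWeight]
  simp only [hpoint, sum_add_distrib, ← mul_sum]
  rw [← hinner, ← houter, ← hcross', ← hcross]
  ring

end EmbeddingInput

/-! ### The conditional expectation over a common denominator. -/

namespace EmbeddingInput

variable (x : EmbeddingInput)

/-- The number `n - k` of free vertices, or `1` if there are none. -/
def freeCount : ℕ := max (x.n - x.k) 1

/-- The number `n - k - 1`, or `1` if that is not positive. -/
def freeCountPred : ℕ := max (x.n - x.k - 1) 1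

/-- The weight of the pair `(u, v)` of positions in the numerator. -/
def pairWeight (u v : Fin x.n) : ℕ :=
  if u ∈ x.firstK then
    if v ∈ x.firstK then x.freeCount * x.freeCountPred else x.freeCountPred
  else if v ∈ x.firstK then x.freeCountPred else 1

open scoped Classical in
/-- The total weight of the possible images with label bit `b` of the ordered edges of `F`. -/
noncomputable def labelCount (b : Bool) : ℕ :=
  ∑ u, ∑ v, ∑ s, ∑ t,
    if x.F.Adj u v ∧ s ∈ x.slot u ∧ t ∈ x.slot v ∧ s ≠ t ∧ x.labelBit s t = b then
      x.pairWeight u v else 0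

/-- The conditional expectation as a fraction of integers. -/
noncomputable def fraction : ℤ × ℕ :=
  ((x.labelCount true : ℤ) - x.labelCount false, 2 * (x.freeCount * x.freeCountPred))

theorem freeCount_pos : 0 < x.freeCount := by unfold freeCount; omega

theorem freeCountPred_pos : 0 < x.freeCountPred := by unfold freeCountPred; omega

theorem fraction_snd_pos : 0 < x.fraction.2 :=
  Nat.mul_pos two_pos (Nat.mul_pos x.freeCount_pos x.freeCountPred_pos)

theorem lt_of_notMem_firstK {v : Fin x.n} (hv : v ∉ x.firstK) : x.k < x.n :=
  (not_lt.mp fun h => hv (x.mem_firstK.mpr h)).trans_lt v.2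

/-- Replacing a factor by `1` is harmless: a position outside the first `k` forces `n - k` to be
positive, two distinct ones force `n - k - 1` to be positive, and otherwise the replaced factor
appears on both sides. -/
theorem pairWeight_mul_card {u v : Fin x.n} (huv : u ≠ v) :
    x.pairWeight u v * #(x.orbitPairs u v) = x.freeCount * x.freeCountPred := by
  by_cases hu : u ∈ x.firstK <;> by_cases hv : v ∈ x.firstK
  · rw [x.card_orbitPairs_mem_mem huv hu hv]
    simp [pairWeight, hu, hv]
  · have := x.lt_of_notMem_firstK hv
    rw [x.card_orbitPairs_mem_notMem hu hv]
    simp only [pairWeight, hu, hv, if_true, if_false]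
    rw [freeCount, max_eq_left (by omega), mul_comm]
  · have := x.lt_of_notMem_firstK hu
    rw [orbitPairs_comm, x.card_orbitPairs_mem_notMem hv hu]
    simp only [pairWeight, hu, hv, if_true, if_false]
    rw [freeCount, max_eq_left (by omega), mul_comm]
  · have h1 : 1 < x.n - x.k := by
      rw [← card_firstK_compl, one_lt_card]
      exact ⟨u, mem_compl.mpr hu, v, mem_compl.mpr hv, huv⟩
    rw [x.card_orbitPairs_notMem_notMem hu hv]
    simp only [pairWeight, hu, hv, if_false]
    rw [freeCount, max_eq_left (by omega), freeCountPred, max_eq_left (by omega), one_mul,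
      Nat.mul_sub_one]

theorem edgeLabel_eq {s t : Fin x.n} (h : s ≠ t) :
    edgeLabel x.c s t = (if x.labelBit s t = true then 1 else 0) -
      (if x.labelBit s t = false then 1 else 0) := by
  simp only [edgeLabel, labelBit, h, ne_eq, not_false_eq_true, dif_pos, decide_eq_true_eq,
    decide_eq_false_iff_not]
  rcases x.c_pm ⟨s(s, t), by simpa using h⟩ with h1 | h1 <;> simp [h1]

open scoped Classical in
-- Since labels are `±1`, a label is the indicator of bit `true` minus that of bit `false`; so the
-- signed sum is a difference of two counts, which keeps the machine's arithmetic in the natural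
-- numbers.
theorem fraction_fst : x.fraction.1 = ∑ u, ∑ v, if x.F.Adj u v then
    (x.pairWeight u v : ℤ) * ∑ p ∈ x.slotPairs u v, edgeLabel x.c p.1 p.2 else 0 := by
  simp only [fraction, labelCount]
  push_cast
  simp only [← sum_sub_distrib]
  refine sum_congr rfl fun u _ => sum_congr rfl fun v _ => ?_
  split_ifs with hadj
  · have : x.slotPairs u v = ({p | p.1 ∈ x.slot u ∧ p.2 ∈ x.slot v ∧ p.1 ≠ p.2} :
        Finset (Fin x.n × Fin x.n)) := by
      ext p
      simp [slotPairs, and_assoc]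
    rw [this, mul_sum, sum_filter, Fintype.sum_prod_type]
    refine sum_congr rfl fun s _ => sum_congr rfl fun t _ => ?_
    by_cases h : s ∈ x.slot u ∧ t ∈ x.slot v ∧ s ≠ t
    · obtain ⟨hs, ht, hst⟩ := h
      rw [x.edgeLabel_eq hst]
      by_cases hb : x.labelBit s t <;> simp [hadj, hs, ht, hst, hb]
    · rw [if_neg h, if_neg fun h' => h ⟨h'.2.1, h'.2.2.1, h'.2.2.2.1⟩,
        if_neg fun h' => h ⟨h'.2.1, h'.2.2.1, h'.2.2.2.1⟩, sub_zero]
  · simp [hadj]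

theorem condExpWeight_eq_fraction :
    x.condExpWeight = (x.fraction.1 : ℚ) / (x.fraction.2 : ℚ) := by
  have h2 : (x.fraction.2 : ℚ) ≠ 0 := by exact_mod_cast x.fraction_snd_pos.ne'
  rw [eq_div_iff h2, fraction_fst]
  have : x.condExpWeight * (x.fraction.2 : ℚ) =
      2 * x.condExpWeight * ((x.freeCount * x.freeCountPred : ℕ) : ℚ) := by
    simp only [fraction]
    push_cast
    ring
  rw [this, two_mul_condExpWeight, sum_mul, Int.cast_sum]
  refine sum_congr rfl fun u _ => ?_
  rw [sum_mul, Int.cast_sum]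
  refine sum_congr rfl fun v _ => ?_
  split_ifs with hadj
  · have h1 : (#(x.orbitPairs u v) : ℚ) ≠ 0 := by
      simpa using (x.orbitPairs_nonempty hadj.ne).ne_empty
    rw [← x.pairWeight_mul_card hadj.ne]
    push_cast
    field_simp
  · simp

end EmbeddingInput

/-! ### Reading the input word by expressions. -/

/-- The number of occurrences of the bit `1` in a word after exactly `c` commas. -/
def onesInSegment : List Γ' → ℕ → ℕ
  | [], _ => 0
  | .comma :: _, 0 => 0
  | .comma :: w, c + 1 => onesInSegment w c
  | a :: w, c => (if a = .bit true ∧ c = 0 then 1 else 0) + onesInSegment w c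

theorem onesInSegment_comma (w : List Γ') (c : ℕ) :
    onesInSegment (.comma :: w) c = if c = 0 then 0 else onesInSegment w (c - 1) := by
  cases c <;> simp [onesInSegment]

theorem onesInSegment_cons {a : Γ'} (ha : a ≠ .comma) (w : List Γ') (c : ℕ) :
    onesInSegment (a :: w) c = (if a = .bit true ∧ c = 0 then 1 else 0) + onesInSegment w c := by
  cases a <;> simp_all [onesInSegment]

/-- The recursion is convenient for evaluating on the encoded input; this positional form is the one
that an expression can compute. -/
theorem onesInSegment_eq_sum (w : List Γ') (c : ℕ) : onesInSegment w c =
    ∑ p ∈ range w.length,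
      if w[p]? = some (.bit true) ∧ (w.take p).count .comma = c then 1 else 0 := by
  induction w generalizing c with
  | nil => simp [onesInSegment]
  | cons a w ih =>
    rw [List.length_cons, sum_range_succ']
    by_cases ha : a = .comma
    · subst ha
      rw [onesInSegment_comma]
      cases c with
      | zero => simp
      | succ c => simp [ih]
    · rw [onesInSegment_cons ha, ih, add_comm]
      congr 1
      · refine sum_congr rfl fun p _ => ?_
        simp [ha]
      · simp [eq_comm]

theorem onesInSegment_append_comma_succ {A : List Γ'} (hA : .comma ∉ A) (B : List Γ') (c : ℕ) :
    onesInSegment (A ++ .comma :: B) (c + 1) = onesInSegment B c := by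
  induction A with
  | nil => rfl
  | cons a A ih =>
    simp only [List.mem_cons, not_or] at hA
    rw [List.cons_append, onesInSegment_cons (Ne.symm hA.1), ih hA.2]
    simp

theorem onesInSegment_unary_zero (n : ℕ) (B : List Γ') :
    onesInSegment (unary n ++ .comma :: B) 0 = n := by
  induction n with
  | zero => rfl
  | succ n ih =>
    rw [unary_succ, List.cons_append, onesInSegment_cons (by simp), ih]
    simp [add_comm]

theorem comma_notMem_unary (n : ℕ) : Γ'.comma ∉ unary n := by
  simp [unary, List.mem_replicate]

theorem onesInSegment_flatMap {α : Type*} (g : α → ℕ) (l : List α) {m : ℕ} (hm : m < l.length) :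
    onesInSegment (l.flatMap fun j => unary (g j) ++ [.comma]) m = g l[m] := by
  induction l generalizing m with
  | nil => simp at hm
  | cons a l ih =>
    rw [List.flatMap_cons, List.append_assoc, List.singleton_append]
    cases m with
    | zero => rw [onesInSegment_unary_zero]; rfl
    | succ m =>
      rw [onesInSegment_append_comma_succ (comma_notMem_unary _), ih (by simpa using hm)]
      rfl

/-- Row-major indexing of a matrix with rows of length `n`, followed by an arbitrary remainder `r`.
-/
theorem getElem?_flatMap_map {α β : Type*} (n : ℕ) (l₁ : List α) {l₂ : List β} (hl : l₂.length = n)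
    {γ : Type*} (f : α → β → γ) {u v : ℕ} (hu : u < l₁.length) (hv : v < l₂.length)
    (r : List γ) :
    ((l₁.flatMap fun a => l₂.map (f a)) ++ r)[u * n + v]? = some (f l₁[u] l₂[v]) := by
  induction l₁ generalizing u with
  | nil => simp at hu
  | cons a l₁ ih =>
    rw [List.flatMap_cons, List.append_assoc]
    cases u with
    | zero => rw [List.getElem?_append_left (by simpa using hv)]; simp [hv]
    | succ u =>
      rw [List.getElem?_append_right (by simp [hl, add_mul]; omega), List.length_map, hl,
        show (u + 1) * n + v - n = u * n + v by rw [add_mul]; omega, ih (by simpa using hu)]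
      rfl

namespace InputExpr

/-- The expression with the value `0`. -/
def zero : InputExpr := sub one one

/-- The truth value of `e = 0`. -/
def isZero (e : InputExpr) : InputExpr := sub one e

/-- The truth value of `a < b`. -/
def lt (a b : InputExpr) : InputExpr := isZero (isZero (sub b a))

/-- The truth value of `a = b`. -/
def eq (a b : InputExpr) : InputExpr := isZero (add (sub a b) (sub b a))

/-- The maximum of `e` and `1`. -/
def maxOne (e : InputExpr) : InputExpr := add e (isZero e)

/-- The number of commas before the position `0`. -/
def commasBefore : InputExpr := sum (var 0) (sym .comma (var 0))

/-- The number of occurrences of the bit `1` after exactly `c` commas; the variable `0` of `c` is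
not used. -/
def ones (c : InputExpr) : InputExpr :=
  sum len (mul (sym (.bit true) (var 0)) (eq commasBefore c))

/-- The number `n`. -/
def numVertices : InputExpr := ones zero

/-- The number `3`. -/
def three : InputExpr := add one (add one one)

/-- The number `k`. -/
def numFixed : InputExpr := sub (sum len (sym .comma (var 0))) three

/-- The image `i_j` of the position `j`. -/
def image (j : ℕ) : InputExpr := ones (add three (var (j + 1)))

/-- The index in the input word of the entry `(u, v)` of the adjacency matrix. -/
def adjIndex (u v : ℕ) : InputExpr :=
  add (add numVertices one) (add (mul (var u) numVertices) (var v))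

/-- The index in the input word of the entry `(s, t)` of the label matrix. -/
def labelIndex (s t : ℕ) : InputExpr :=
  add (add (add numVertices one) (add (mul numVertices numVertices) one))
    (add (mul (var s) numVertices) (var t))

/-- The truth value of `u ∈ [k]`. -/
def isFixed (u : ℕ) : InputExpr := lt (var u) numFixed

/-- The truth value of `s` being a possible image of `u`. -/
def inSlot (u s : ℕ) : InputExpr :=
  add (mul (isFixed u) (eq (var s) (image u)))
    (mul (isZero (isFixed u)) (isZero (sum numFixed (eq (var (s + 1)) (image 0)))))

/-- The number `n - k`, or `1`. -/
def freeCount : InputExpr := maxOne (sub numVertices numFixed)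

/-- The number `n - k - 1`, or `1`. -/
def freeCountPred : InputExpr := maxOne (sub (sub numVertices numFixed) one)

/-- The weight of a pair of positions. -/
def pairWeight (u v : ℕ) : InputExpr :=
  add (mul (isFixed u) (add (mul (isFixed v) (mul freeCount freeCountPred))
      (mul (isZero (isFixed v)) freeCountPred)))
    (mul (isZero (isFixed u)) (add (mul (isFixed v) freeCountPred) (isZero (isFixed v))))

/-- The total weight of the possible images with label bit `b` of the ordered edges. -/
def labelCount (b : Bool) : InputExpr :=
  sum numVertices (sum numVertices (sum numVertices (sum numVertices
    (mul (sym (.bit true) (adjIndex 3 2)) (mul (inSlot 3 1) (mul (inSlot 2 0)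
      (mul (isZero (eq (var 1) (var 0))) (mul (sym (.bit b) (labelIndex 1 0))
        (pairWeight 3 2)))))))))

section Val

variable (w : List Γ') (ρ : ℕ → ℕ)

theorem val_isZero (e : InputExpr) : e.isZero.val w ρ = if e.val w ρ = 0 then 1 else 0 := by
  simp only [isZero, val]
  split_ifs <;> omega

theorem val_lt (a b : InputExpr) :
    (lt a b).val w ρ = if a.val w ρ < b.val w ρ then 1 else 0 := by
  by_cases h : a.val w ρ < b.val w ρ
  · simp [lt, val_isZero, val, h, Nat.sub_eq_zero_iff_le]
  · simp [lt, val_isZero, val, h, not_lt.mp h]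

theorem val_eq (a b : InputExpr) :
    (eq a b).val w ρ = if a.val w ρ = b.val w ρ then 1 else 0 := by
  have : a.val w ρ = b.val w ρ ↔ a.val w ρ - b.val w ρ + (b.val w ρ - a.val w ρ) = 0 := by omega
  rw [eq, val_isZero]
  exact if_congr this.symm rfl rfl

theorem val_maxOne (e : InputExpr) : e.maxOne.val w ρ = max (e.val w ρ) 1 := by
  simp only [maxOne, val, val_isZero]
  split_ifs <;> omega

theorem sum_range_symbolAt_comma {m : ℕ} (hm : m ≤ w.length) :
    ∑ p ∈ range m, symbolAt w .comma p = (w.take m).count .comma := by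
  induction m with
  | zero => simp
  | succ m ih =>
    have e : w.take (m + 1) = w.take m ++ [w[m]] := by simp
    rw [sum_range_succ, ih (by omega), e, List.count_append, symbolAt,
      List.getElem?_eq_getElem (by omega), List.count_singleton]
    simp

theorem val_ones (c : InputExpr) (m : ℕ) (hc : ∀ p, c.val w (scons p ρ) = m) :
    (ones c).val w ρ = onesInSegment w m := by
  rw [onesInSegment_eq_sum]
  simp only [ones, val, val_eq, hc, commasBefore, scons]
  refine sum_congr rfl fun p hp => ?_
  rw [sum_range_symbolAt_comma w (mem_range.mp hp).le, symbolAt]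
  split_ifs <;> simp_all

end Val

end InputExpr

/-! ### Values of the expressions on the encoded input. -/

namespace EmbeddingInput

variable (x : EmbeddingInput)

open scoped Classical in
theorem encode_eq : x.encode = unary x.n ++ .comma ::
    (((List.finRange x.n).flatMap fun u => (List.finRange x.n).map fun v =>
      Γ'.bit (decide (x.F.Adj u v))) ++ .comma ::
    (((List.finRange x.n).flatMap fun u => (List.finRange x.n).map fun v =>
      Γ'.bit (x.labelBit u v)) ++ .comma ::
    ((List.finRange x.k).flatMap fun j => unary (x.i j) ++ [.comma]))) := by
  simp only [encode, unary, List.append_assoc, List.cons_append,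
    List.nil_append]

theorem comma_notMem_flatMap {n : ℕ} (f : Fin n → Fin n → Bool) :
    Γ'.comma ∉ (List.finRange n).flatMap fun u =>
      (List.finRange n).map fun v => Γ'.bit (f u v) := by
  simp

theorem length_flatMap_finRange {n : ℕ} (f : Fin n → Fin n → Bool) :
    ((List.finRange n).flatMap fun u => (List.finRange n).map fun v => Γ'.bit (f u v)).length =
      n * n := by
  simp [List.length_flatMap]

theorem onesInSegment_encode_zero : onesInSegment x.encode 0 = x.n := by
  rw [encode_eq, onesInSegment_unary_zero]

theorem onesInSegment_encode_add (j : Fin x.k) : onesInSegment x.encode (3 + j) = x.i j := by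
  classical
  rw [encode_eq, show 3 + (j : ℕ) = j + 1 + 1 + 1 by omega,
    onesInSegment_append_comma_succ (comma_notMem_unary _),
    onesInSegment_append_comma_succ (comma_notMem_flatMap _),
    onesInSegment_append_comma_succ (comma_notMem_flatMap _),
    onesInSegment_flatMap (fun j => (x.i j : ℕ)) (List.finRange x.k) (by simp)]
  simp

/-- Three separators follow `n` and the two matrices, and each `i_j` is terminated by one comma. -/
theorem count_comma_encode : x.encode.count .comma = x.k + 3 := by
  classical
  have h : ∀ j : Fin x.k, (unary (x.i j) ++ [Γ'.comma]).count .comma = 1 := fun j => by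
    rw [List.count_append, List.count_eq_zero_of_not_mem (comma_notMem_unary _)]
    simp
  rw [encode_eq]
  simp only [List.count_append, List.count_cons_self,
    List.count_eq_zero_of_not_mem (comma_notMem_unary _),
    List.count_eq_zero_of_not_mem (comma_notMem_flatMap _), List.count_flatMap]
  simp [Function.comp_def, h]

theorem getElem?_encode_adj (u v : Fin x.n) :
    x.encode[x.n + 1 + (u * x.n + v)]? = some (.bit true) ↔ x.F.Adj u v := by
  classical
  rw [encode_eq, List.getElem?_append_right (by simp [length_unary]; omega), length_unary,
    show x.n + 1 + (u * x.n + v) - x.n = u * x.n + v + 1 by omega, List.getElem?_cons_succ,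
    getElem?_flatMap_map x.n _ (by simp) _ (by simp) (by simp)]
  simp

theorem getElem?_encode_label (s t : Fin x.n) (b : Bool) :
    x.encode[x.n + 1 + (x.n * x.n + 1) + (s * x.n + t)]? = some (.bit b) ↔ x.labelBit s t = b := by
  classical
  rw [encode_eq, List.getElem?_append_right (by simp [length_unary]; omega), length_unary,
    show x.n + 1 + (x.n * x.n + 1) + (s * x.n + t) - x.n =
      x.n * x.n + 1 + (s * x.n + t) + 1 by omega, List.getElem?_cons_succ,
    List.getElem?_append_right (by rw [length_flatMap_finRange]; omega), length_flatMap_finRange,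
    show x.n * x.n + 1 + (s * x.n + t) - x.n * x.n = s * x.n + t + 1 by omega,
    List.getElem?_cons_succ, getElem?_flatMap_map x.n _ (by simp) _ (by simp) (by simp)]
  simp

theorem val_numVertices (ρ : ℕ → ℕ) : InputExpr.numVertices.val x.encode ρ = x.n := by
  rw [InputExpr.numVertices, InputExpr.val_ones _ _ _ 0 fun _ => rfl, onesInSegment_encode_zero]

theorem val_numFixed (ρ : ℕ → ℕ) : InputExpr.numFixed.val x.encode ρ = x.k := by
  simp only [InputExpr.numFixed, InputExpr.val, scons, InputExpr.three]
  rw [InputExpr.sum_range_symbolAt_comma _ le_rfl, List.take_length, count_comma_encode]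
  rfl

theorem val_image {ρ : ℕ → ℕ} {u : ℕ} (j : Fin x.k) (hu : ρ u = j) :
    (InputExpr.image u).val x.encode ρ = x.i j := by
  rw [InputExpr.image, InputExpr.val_ones _ _ _ (3 + j), onesInSegment_encode_add]
  intro p
  simp [InputExpr.val, InputExpr.three, scons, hu]

theorem val_isFixed {ρ : ℕ → ℕ} {u : ℕ} {v : Fin x.n} (hu : ρ u = v) :
    (InputExpr.isFixed u).val x.encode ρ = if v ∈ x.firstK then 1 else 0 := by
  simp only [InputExpr.isFixed, InputExpr.val_lt, InputExpr.val, val_numFixed, hu, mem_firstK]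

theorem val_inSlot {ρ : ℕ → ℕ} {a b : ℕ} {u s : Fin x.n} (hu : ρ a = u) (hs : ρ b = s) :
    (InputExpr.inSlot a b).val x.encode ρ = if s ∈ x.slot u then 1 else 0 := by
  -- The sum counts the `j` with `i_j = s`, so it vanishes exactly when `s` is unoccupied. The index
  -- `b + 1` accounts for the bound variable `j`.
  have hsum : (∑ j ∈ range x.k, (InputExpr.eq (.var (b + 1)) (.image 0)).val x.encode
      (scons j ρ)) = 0 ↔ s ∉ x.used := by
    rw [sum_range, sum_eq_zero_iff]
    simp only [used, mem_univ, forall_true_left, mem_image, true_and, not_exists]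
    refine forall_congr' fun j => ?_
    rw [InputExpr.val_eq, x.val_image j rfl]
    simp [InputExpr.val, scons, hs, Fin.ext_iff, eq_comm]
  simp only [InputExpr.inSlot, InputExpr.val, InputExpr.val_isZero, x.val_isFixed hu,
    val_numFixed, hsum, InputExpr.val_eq _ _ (.var b)]
  by_cases h : u ∈ x.firstK
  · rw [x.val_image ⟨u, x.mem_firstK.mp h⟩ hu]
    simp [slot, h, hs, Fin.ext_iff]
  · simp [slot, h]

theorem val_freeCount (ρ : ℕ → ℕ) : InputExpr.freeCount.val x.encode ρ = x.freeCount := by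
  simp only [InputExpr.freeCount, InputExpr.val_maxOne, InputExpr.val, val_numVertices,
    val_numFixed, freeCount]

theorem val_freeCountPred (ρ : ℕ → ℕ) :
    InputExpr.freeCountPred.val x.encode ρ = x.freeCountPred := by
  simp only [InputExpr.freeCountPred, InputExpr.val_maxOne, InputExpr.val, val_numVertices,
    val_numFixed, freeCountPred]

theorem val_pairWeight {ρ : ℕ → ℕ} {a b : ℕ} {u v : Fin x.n} (hu : ρ a = u) (hv : ρ b = v) :
    (InputExpr.pairWeight a b).val x.encode ρ = x.pairWeight u v := by
  simp only [InputExpr.pairWeight, InputExpr.val, InputExpr.val_isZero, x.val_isFixed hu,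
    x.val_isFixed hv, val_freeCount, val_freeCountPred, pairWeight]
  split_ifs <;> simp_all

theorem val_labelCount (b : Bool) (ρ : ℕ → ℕ) :
    (InputExpr.labelCount b).val x.encode ρ = x.labelCount b := by
  classical
  simp only [InputExpr.labelCount, labelCount, InputExpr.val, val_numVertices]
  rw [sum_range]
  refine sum_congr rfl fun u _ => ?_
  rw [sum_range]
  refine sum_congr rfl fun v _ => ?_
  rw [sum_range]
  refine sum_congr rfl fun s _ => ?_
  rw [sum_range]
  refine sum_congr rfl fun t _ => ?_
  -- Under the four summations `u`, `v`, `s`, `t` have the de Bruijn numbers `3`, `2`, `1`, `0`.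
  rw [x.val_inSlot (u := u) (s := s) rfl rfl, x.val_inSlot (u := v) (s := t) rfl rfl,
    x.val_pairWeight (u := u) (v := v) rfl rfl]
  simp only [InputExpr.adjIndex, InputExpr.labelIndex, InputExpr.val, InputExpr.val_isZero,
    InputExpr.val_eq, val_numVertices, scons, InputExpr.symbolAt, getElem?_encode_adj,
    getElem?_encode_label]
  by_cases h1 : x.F.Adj u v <;> by_cases h2 : s ∈ x.slot u <;> by_cases h3 : t ∈ x.slot v <;>
    by_cases h4 : s = t <;> by_cases h5 : x.labelBit s t = b <;>
    simp [h1, h2, h3, h4, h5, Fin.val_inj]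

theorem fraction_computableInPolyTime :
    Nonempty (Turing.TM2ComputableInPolyTime encode encodeFraction fraction) := by
  refine InputExpr.computableInPolyTime (.lt (.labelCount true) (.labelCount false))
    -- With truncated subtraction, the absolute difference is the sum of the two one-sided
    -- differences.
    (.add (.sub (.labelCount true) (.labelCount false))
      (.sub (.labelCount false) (.labelCount true)))
    (.mul (.add .one .one) (.mul .freeCount .freeCountPred)) ?_ ?_ ?_
  · intro x
    rw [InputExpr.val_lt, val_labelCount, val_labelCount]
    simp [fraction]
  · intro x
    simp only [InputExpr.val, val_labelCount, fraction]
    omega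
  · intro x
    simp only [InputExpr.val, val_freeCount, val_freeCountPred, fraction]

end EmbeddingInput

theorem lemma1 :
    -- the conditional expectation is the average over the permutations with the given prefix,
    -- and it is given by the explicit formula
    (∀ x : EmbeddingInput,
      x.condExpWeight =
          1 / ((x.n - x.k)! : ℚ) * ∑ π ∈ x.event, (weight x.c (edgesOf (x.copy π)) : ℚ) ∧
      x.event.Nonempty ∧
      ∀ π ∈ x.event,
        x.condExpWeight =
          (weight x.c (edgesWithin (x.copy π) x.used) : ℚ)
          + ∑ j : Fin x.k,
              avgWeight x.c (edgesLeaving (x.i j) x.used) *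
                ((x.F.neighborSet (x.pos j) \ (x.firstK : Set (Fin x.n))).ncard : ℚ)
          + avgWeight x.c (edgesWithin ⊤ x.usedᶜ) * (#(edgesWithin x.F x.firstKᶜ) : ℚ)) ∧
    -- and a single polynomial-time Turing machine computes it, as a fraction, from the input
    (∃ f : EmbeddingInput → ℤ × ℕ,
      (∀ x, 0 < (f x).2 ∧ x.condExpWeight = ((f x).1 : ℚ) / ((f x).2 : ℚ)) ∧
      Nonempty (Turing.TM2ComputableInPolyTime EmbeddingInput.encode encodeFraction f)) := by
  refine ⟨fun x => ⟨?_, x.event_nonempty, fun π hπ => x.condExpWeight_eq_explicit hπ⟩,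
    EmbeddingInput.fraction, fun x => ⟨x.fraction_snd_pos, x.condExpWeight_eq_fraction⟩,
    EmbeddingInput.fraction_computableInPolyTime⟩
  rw [x.condExpWeight_eq, x.card_event, one_div, div_eq_inv_mul]
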